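/- **Corollary 3.4.** Let $X$ and $Y$ be Banach spaces over the same field $\mathbb K\in\{\mathbb R,\mathbb C\}$, let $\Omega$ be a compact Hausdorff space, and write $\mathcal C(\Omega)=\mathcal C(\Omega,\mathbb K)$. Let $1\le p\le\infty$ and let $p'$ be its conjugate index ($1/p+1/p'=1$, $1/\infty=0$). Notation. For a Banach space $E$ and a finite or infinite system $(x_i)$ in $E$, $\|(x_i)\|_q$ is the usual $\ell_q$-norm of $(\|x_i\|)$, and $\|(x_i)\|_q^w=\sup\{\|(x^*(x_i))\|_q : x^*\in E^*,\ \|x^*\|\le 1\}$. $\ell_q(E)$ is the space of sequences with $\|(x_i)\|_q<\infty$; $c_0(E)$ is the space of norm-null sequences; $\ell_q^w(E)$ is the space of sequences with $(x^*(x_i))\in\ell_q$ for every $x^*\in E^*$, normed by $\|\cdot\|_q^w$; and $\ell_q^u(E)$ is the set of those $(x_i)\in\ell_q^w(E)$ that are the $\|\cdot\|_q^w$-limit of their truncations $(x_1,\dots,x_N,0,0,\dots)$. The space $\mathcal C_p(\Omega,X)$ consists of all $f\in\mathcal C(\Omega,X)$ for which there is $(x_n)\in\ell_p(X)$ (with $(x_n)\in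 c_0(X)$ if $p=\infty$) such that $f(\Omega)\subset\{\sum_n\alpha_nx_n : (\alpha_n)\in B_{\ell_{p'}}\}$, where $B_{\ell_{p'}}$ is the closed unit ball of $\ell_{p'}$; its norm is the infimum of $\|(x_n)\|_p$ over all such sequences $(x_n)$. $\mathcal L(E,F)$ is the Banach space of bounded linear operators from $E$ to $F$. For $U\in\mathcal L(\mathcal C_p(\Omega,X),Y)$ or $U\in\mathcal L(\mathcal C(\Omega,X),Y)$ (supremum norm), the associated operator $U^{\#}$ is given by $(U^{\#}\varphi)x=U(\varphi x)$ for $\varphi\in\mathcal C(\Omega)$, $x\in X$, where $(\varphi x)(\omega)=\varphi(\omega)x$. Let $S\in\mathcal L(\mathcal C(\Omega),\mathcal L(X,Y))$. The following statements are equivalent. (a) There exists $U\in\mathcal L(\mathcal C_p(\Omega,X),Y)$ such that $U^{\#}=S$. (b) There exists a constant $c>0$ such that, for all finite systems $(x_i)_{i=1}^n\subset X$ and $(\varphi_i)_{i=1}^n\subset\mathcal C(\Omega)$, $$\|((S\varphi_i)x_i)\|_{p'}^w\le c\,\|(x_i)\|_\infty\,\|(\varphi_i)\|_{p'}^w .$$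 (b$'$) There exists a constant $c>0$ such that, for all $(x_i)\in\ell_\infty(X)$ and $(\varphi_i)\in\ell_{p'}^w(\mathcal C(\Omega))$ and all $n\in\mathbb N$, $$\|((S\varphi_i)x_i)_{i=n}^\infty\|_{p'}^w\le c\,\|(x_i)_{i=n}^\infty\|_\infty\,\|(\varphi_i)_{i=n}^\infty\|_{p'}^w .$$ (c) If $(x_i)\in\ell_\infty(X)$ and $(\varphi_i)\in\ell_{p'}^w(\mathcal C(\Omega))$, then $((S\varphi_i)x_i)\in\ell_{p'}^w(Y)$. (d) If $(x_i)\in c_0(X)$ and $(\varphi_i)\in\ell_{p'}^w(\mathcal C(\Omega))$, then $((S\varphi_i)x_i)\in\ell_{p'}^u(Y)$. (d$'$) If $(x_i)\in\ell_\infty(X)$ and $(\varphi_i)\in\ell_{p'}^u(\mathcal C(\Omega))$, then $((S\varphi_i)x_i)\in\ell_{p'}^u(Y)$. Moreover, for $p=\infty$ (so $p'=1$), each of the conditions (b), (b$'$), (c), (d), (d$'$) is equivalent to the existence of $U\in\mathcal L(\mathcal C(\Omega,X),Y)$ such that $U^{\#}=S$. -/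

import Mathlib

open Filter Topology
open scoped ENNReal NNReal

noncomputable section

namespace PCont

/-! ### Norms of finite and infinite systems of vectors -/

/-- The norm `‖(x i)‖_p` of a system of vectors (a finite system for `ι = Fin n`, a sequence for
`ι = ℕ`), with values in `[0, ∞]`. A sequence `x` lies in `ℓ_p(E)` iff `pnorm p x < ∞`. -/
def pnorm {ι E : Type*} [SeminormedAddCommGroup E] (p : ℝ≥0∞) (x : ι → E) : ℝ≥0∞ :=
  if p = ∞ then ⨆ i, ‖x i‖ₑ else (∑' i, ‖x i‖ₑ ^ p.toReal) ^ (1 / p.toReal)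

/-- The weak norm `‖(x i)‖_p^w = sup { ‖(f (x i))‖_p : f in the closed unit ball of the dual }`,
with values in `[0, ∞]`. -/
def wnorm (𝕜 : Type*) {ι E : Type*} [RCLike 𝕜] [NormedAddCommGroup E] [NormedSpace 𝕜 E]
    (p : ℝ≥0∞) (x : ι → E) : ℝ≥0∞ :=
  ⨆ (f : StrongDual 𝕜 E) (_ : ‖f‖ ≤ 1), pnorm p (fun i => f (x i))

/-- `x ∈ ℓ_p^w(E)`: every functional maps `x` to a scalar sequence in `ℓ_p`. -/
def WeaklySummable (𝕜 : Type*) {E : Type*} [RCLike 𝕜] [NormedAddCommGroup E] [NormedSpace 𝕜 E]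
    (p : ℝ≥0∞) (x : ℕ → E) : Prop :=
  ∀ f : StrongDual 𝕜 E, pnorm p (fun i => f (x i)) < ∞

/-- `x ∈ ℓ_p^u(E)`: `x ∈ ℓ_p^w(E)` is the limit, in the weak norm, of its truncations
`(x_0, …, x_{N-1}, 0, 0, …)`. -/
def UncondSummable (𝕜 : Type*) {E : Type*} [RCLike 𝕜] [NormedAddCommGroup E] [NormedSpace 𝕜 E]
    (p : ℝ≥0∞) (x : ℕ → E) : Prop :=
  WeaklySummable 𝕜 p x ∧
    Tendsto (fun N : ℕ => wnorm 𝕜 p (fun i => x i - if i < N then x i else 0)) atTop (𝓝 0)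

/-! ### `p`-compact sets -/

/-- `x ∈ ℓ_p(E)` if `p < ∞`, and `x ∈ c_0(E)` if `p = ∞`. -/
def MemLpC0 {E : Type*} [SeminormedAddCommGroup E] (p : ℝ≥0∞) (x : ℕ → E) : Prop :=
  pnorm p x < ∞ ∧ (p = ∞ → Tendsto x atTop (𝓝 0))

/-- The set `{ ∑ αₙ xₙ : (αₙ) in the closed unit ball of ℓ_{p'} }`. -/
def hull (𝕜 : Type*) {E : Type*} [RCLike 𝕜] [NormedAddCommGroup E] [NormedSpace 𝕜 E]
    (p : ℝ≥0∞) (x : ℕ → E) : Set E :=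
  {v | ∃ α : ℕ → 𝕜, pnorm p.conjExponent α ≤ 1 ∧ HasSum (fun n => α n • x n) v}

/-- `K` is `p`-compact (in the sense of Sinha and Karn). -/
def IsPCompact (𝕜 : Type*) {E : Type*} [RCLike 𝕜] [NormedAddCommGroup E] [NormedSpace 𝕜 E]
    (p : ℝ≥0∞) (K : Set E) : Prop :=
  ∃ x : ℕ → E, MemLpC0 p x ∧ K ⊆ hull 𝕜 p x

section lemmas

variable {ι κ E : Type*} [NormedAddCommGroup E]

lemma pnorm_top (x : ι → E) : pnorm ∞ x = ⨆ i, ‖x i‖ₑ := by simp [pnorm]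

lemma pnorm_of_ne_top {p : ℝ≥0∞} (hp : p ≠ ∞) (x : ι → E) :
    pnorm p x = (∑' i, ‖x i‖ₑ ^ p.toReal) ^ (1 / p.toReal) := by simp [pnorm, hp]

lemma toReal_pos_of_fact (p : ℝ≥0∞) [hp : Fact (1 ≤ p)] (h : p ≠ ∞) : 0 < p.toReal :=
  ENNReal.toReal_pos (one_pos.trans_le hp.out).ne' h

lemma pnorm_rpow {p : ℝ≥0∞} [Fact (1 ≤ p)] (hp : p ≠ ∞) (x : ι → E) :
    pnorm p x ^ p.toReal = ∑' i, ‖x i‖ₑ ^ p.toReal := by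
  have := toReal_pos_of_fact p hp
  rw [pnorm_of_ne_top hp, ← ENNReal.rpow_mul, one_div_mul_cancel this.ne', ENNReal.rpow_one]

/-- `pnorm p` is finite exactly on Mathlib's `ℓ_p` sequences. -/
lemma pnorm_lt_top_iff {p : ℝ≥0∞} [Fact (1 ≤ p)] (x : ι → E) :
    pnorm p x < ∞ ↔ Memℓp x p := by
  by_cases hp : p = ∞
  · subst hp
    rw [pnorm_top, memℓp_infty_iff]
    constructor
    · intro h
      refine ⟨(⨆ i, ‖x i‖ₑ).toReal, ?_⟩
      rintro _ ⟨i, rfl⟩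
      have := ENNReal.toReal_mono h.ne (le_iSup (fun i => ‖x i‖ₑ) i)
      simpa using this
    · rintro ⟨C, hC⟩
      refine lt_of_le_of_lt (iSup_le fun i => ?_) (ENNReal.ofReal_lt_top (r := C))
      rw [← ofReal_norm]
      exact ENNReal.ofReal_le_ofReal (hC ⟨i, rfl⟩)
  · have h0 := toReal_pos_of_fact p hp
    rw [memℓp_gen_iff h0, ← ENNReal.rpow_lt_top_iff_of_pos h0, pnorm_rpow hp, lt_top_iff_ne_top,
      ← ENNReal.tsum_coe_ne_top_iff_summable_coe (f := fun i => ‖x i‖₊ ^ p.toReal) |>.trans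
        (by simp : _ ↔ Summable fun i => ‖x i‖ ^ p.toReal)]
    simp [ENNReal.coe_rpow_of_nonneg _ h0.le, enorm_eq_nnnorm]

lemma pnorm_smul {𝕜 : Type*} [NormedField 𝕜] [NormedSpace 𝕜 E] {p : ℝ≥0∞} [Fact (1 ≤ p)]
    (c : 𝕜) (x : ι → E) :
    pnorm p (fun i => c • x i) = ‖c‖ₑ * pnorm p x := by
  by_cases hp : p = ∞
  · subst hp
    simp only [pnorm_top, enorm_smul, ENNReal.mul_iSup]
  · have h0 := toReal_pos_of_fact p hp
    simp only [pnorm_of_ne_top hp, enorm_smul, ENNReal.mul_rpow_of_nonneg _ _ h0.le]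
    rw [ENNReal.tsum_mul_left, ENNReal.mul_rpow_of_nonneg _ _ (by positivity),
      ← ENNReal.rpow_mul, mul_one_div_cancel h0.ne', ENNReal.rpow_one]

lemma pnorm_comp_equiv {p : ℝ≥0∞} (e : κ ≃ ι) (x : ι → E) :
    pnorm p (fun k => x (e k)) = pnorm p x := by
  unfold pnorm
  split_ifs
  · exact e.iSup_comp (g := fun i => ‖x i‖ₑ)
  · rw [e.tsum_eq (fun i => ‖x i‖ₑ ^ p.toReal)]

lemma pnorm_sum_le {p : ℝ≥0∞} [Fact (1 ≤ p)] {x : ι → E} {y : κ → E} {A B C : ℝ}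
    (hA : 0 ≤ A) (hB : 0 ≤ B) (hC : 0 ≤ C)
    (hx : pnorm p x ≤ ENNReal.ofReal A) (hy : pnorm p y ≤ ENNReal.ofReal B)
    (h1 : p = ∞ → A ≤ C ∧ B ≤ C)
    (h2 : p ≠ ∞ → A ^ p.toReal + B ^ p.toReal ≤ C ^ p.toReal) :
    pnorm p (Sum.elim x y) ≤ ENNReal.ofReal C := by
  by_cases hp : p = ∞
  · subst hp
    rw [pnorm_top] at *
    refine iSup_le ?_
    rintro (i | i)
    · exact (le_iSup (fun i => ‖x i‖ₑ) i).trans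
        (hx.trans (ENNReal.ofReal_le_ofReal (h1 rfl).1))
    · exact (le_iSup (fun i => ‖y i‖ₑ) i).trans
        (hy.trans (ENNReal.ofReal_le_ofReal (h1 rfl).2))
  · have h0 := toReal_pos_of_fact p hp
    rw [← ENNReal.rpow_le_rpow_iff h0] at hx hy ⊢
    rw [pnorm_rpow hp, ENNReal.ofReal_rpow_of_nonneg (by assumption) h0.le] at *
    have : ∑' i, ‖Sum.elim x y i‖ₑ ^ p.toReal
        = (∑' i, ‖x i‖ₑ ^ p.toReal) + ∑' i, ‖y i‖ₑ ^ p.toReal :=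
      Summable.tsum_sum ENNReal.summable ENNReal.summable
    rw [this]
    refine (add_le_add hx hy).trans ?_
    rw [← ENNReal.ofReal_add (by positivity) (by positivity)]
    exact ENNReal.ofReal_le_ofReal (h2 hp)

lemma pnorm_single [DecidableEq ι] {p : ℝ≥0∞} [Fact (1 ≤ p)] (j : ι) (v : E) :
    pnorm p (fun i => if i = j then v else 0) = ‖v‖ₑ := by
  by_cases hp : p = ∞
  · subst hp
    rw [pnorm_top]
    refine le_antisymm (iSup_le fun i => ?_) ?_
    · split_ifs <;> simp
    · exact le_trans (by simp) (le_iSup (fun i => ‖if i = j then v else (0 : E)‖ₑ) j)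
  · have h0 := toReal_pos_of_fact p hp
    rw [pnorm_of_ne_top hp, tsum_eq_single j]
    · rw [if_pos rfl, ← ENNReal.rpow_mul, mul_one_div_cancel h0.ne', ENNReal.rpow_one]
    · intro i hi
      simp [hi, h0]

end lemmas

section hull

variable {𝕜 E : Type*} [RCLike 𝕜] [NormedAddCommGroup E] [NormedSpace 𝕜 E]

instance fact_conj (p : ℝ≥0∞) : Fact (1 ≤ p.conjExponent) :=
  ⟨by unfold ENNReal.conjExponent; exact le_self_add⟩

lemma tsum_mul_le {𝕜 E : Type*} [RCLike 𝕜] [NormedAddCommGroup E] {p : ℝ≥0∞}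
    [hp : Fact (1 ≤ p)] (α : ℕ → 𝕜) (x : ℕ → E) :
    ∑' n, ‖α n‖ₑ * ‖x n‖ₑ ≤ pnorm p.conjExponent α * pnorm p x := by
  by_cases h1 : p = 1
  · subst h1
    have : ENNReal.conjExponent 1 = ∞ := by simp [ENNReal.conjExponent]
    rw [this, pnorm_top, pnorm_of_ne_top (by simp)]
    simp only [ENNReal.toReal_one, ENNReal.rpow_one, div_one]
    rw [← ENNReal.tsum_mul_left]
    exact ENNReal.tsum_le_tsum fun n => by gcongr; exact le_iSup (fun n => ‖α n‖ₑ) n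
  by_cases h2 : p = ∞
  · subst h2
    have : ENNReal.conjExponent ∞ = 1 := by simp [ENNReal.conjExponent]
    rw [this, pnorm_top, pnorm_of_ne_top (by simp)]
    simp only [ENNReal.toReal_one, ENNReal.rpow_one, div_one]
    rw [← ENNReal.tsum_mul_right]
    exact ENNReal.tsum_le_tsum fun n => by gcongr; exact le_iSup (fun n => ‖x n‖ₑ) n
  have hlt : 1 < p := lt_of_le_of_ne hp.out (Ne.symm h1)
  have hq : p.conjExponent ≠ ∞ := by
    have : p - 1 ≠ 0 := (tsub_pos_of_lt hlt).ne'
    simp [ENNReal.conjExponent, this]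
  have hc : p.toReal.HolderConjugate p.conjExponent.toReal :=
    ENNReal.HolderConjugate.toReal_of_ne_top (p := p) (q := p.conjExponent) h2 hq
  have := toReal_pos_of_fact p h2
  have := toReal_pos_of_fact p.conjExponent hq
  rw [ENNReal.tsum_eq_iSup_sum]
  refine iSup_le fun s => ?_
  refine (ENNReal.inner_le_Lp_mul_Lq s _ _ hc.symm).trans ?_
  rw [pnorm_of_ne_top hq, pnorm_of_ne_top h2]
  gcongr <;> exact ENNReal.sum_le_tsum s

lemma enorm_le_of_mem_hull {p : ℝ≥0∞} [Fact (1 ≤ p)] {x : ℕ → E} {v : E}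
    (hv : v ∈ hull 𝕜 p x) : ‖v‖ₑ ≤ pnorm p x := by
  obtain ⟨α, hα, hs⟩ := hv
  have h : ∑' n, ‖α n‖ₑ * ‖x n‖ₑ ≤ pnorm p x :=
    (tsum_mul_le α x).trans (mul_le_of_le_one_left' hα)
  refine le_of_tendsto hs.enorm (Eventually.of_forall fun s => ?_)
  refine (enorm_sum_le s _).trans (le_trans ?_ h)
  simp only [enorm_smul]
  exact ENNReal.sum_le_tsum s

lemma exists_hull_add {p : ℝ≥0∞} [Fact (1 ≤ p)] {x y : ℕ → E} {a b : ℝ} (ha : 0 < a) (hb : 0 < b)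
    (hx : MemLpC0 p x) (hy : MemLpC0 p y)
    (hxa : pnorm p x ≤ ENNReal.ofReal a) (hyb : pnorm p y ≤ ENNReal.ofReal b) :
    ∃ z : ℕ → E, MemLpC0 p z ∧ pnorm p z ≤ ENNReal.ofReal (a + b) ∧
      ∀ v ∈ hull 𝕜 p x, ∀ w ∈ hull 𝕜 p y, v + w ∈ hull 𝕜 p z := by
  set q := p.conjExponent with hq
  set u : ℝ := (a / (a + b)) ^ (q.toReal)⁻¹ with hu
  set t : ℝ := (b / (a + b)) ^ (q.toReal)⁻¹ with ht
  have hu0 : 0 < u := by positivity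
  have ht0 : 0 < t := by positivity
  let e := Equiv.natSumNatEquivNat
  let z : ℕ → E := fun n => Sum.elim (fun i => ((u⁻¹ : ℝ) : 𝕜) • x i)
    (fun i => ((t⁻¹ : ℝ) : 𝕜) • y i) (e.symm n)
  have hpq : p.toReal⁻¹ + q.toReal⁻¹ = 1 := by
    have h := ENNReal.HolderConjugate.inv_add_inv_eq_one p q
    have h' := congrArg ENNReal.toReal h
    rwa [ENNReal.toReal_add (by simp [(one_pos.trans_le (Fact.out : 1 ≤ p)).ne'])
      (by simp [(one_pos.trans_le (Fact.out : 1 ≤ q)).ne']), ENNReal.toReal_inv,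
      ENNReal.toReal_inv, ENNReal.toReal_one] at h'
  have hz : pnorm p z ≤ ENNReal.ofReal (a + b) := by
    rw [pnorm_comp_equiv e.symm]
    refine pnorm_sum_le (A := u⁻¹ * a) (B := t⁻¹ * b) (by positivity) (by positivity)
      (by positivity) ?_ ?_ ?_ ?_
    · rw [pnorm_smul, ENNReal.ofReal_mul (by positivity), ← ofReal_norm, RCLike.norm_ofReal,
        abs_of_pos (by positivity)]
      gcongr
    · rw [pnorm_smul, ENNReal.ofReal_mul (by positivity), ← ofReal_norm, RCLike.norm_ofReal,
        abs_of_pos (by positivity)]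
      gcongr
    · rintro rfl
      have : q.toReal = 1 := by simp [hq, ENNReal.conjExponent]
      rw [hu, ht, this]
      simp only [inv_one, Real.rpow_one]
      constructor <;> (apply le_of_eq; field_simp)
    · intro hp
      have h0 := toReal_pos_of_fact p hp
      have hexp : q.toReal⁻¹ * p.toReal = p.toReal - 1 := by
        have : q.toReal⁻¹ = 1 - p.toReal⁻¹ := by linarith
        rw [this]; field_simp
      have aux (s : ℝ) (hs : 0 < s) :
          (((s / (a + b)) ^ (q.toReal)⁻¹)⁻¹ * s) ^ p.toReal = (a + b) ^ (p.toReal - 1) * s := by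
        rw [Real.mul_rpow (by positivity) hs.le, Real.inv_rpow (by positivity),
          ← Real.rpow_mul (by positivity), hexp, Real.div_rpow hs.le (by positivity),
          Real.rpow_sub_one hs.ne']
        have := (Real.rpow_pos_of_pos hs p.toReal).ne'
        have := (Real.rpow_pos_of_pos (add_pos ha hb) (p.toReal - 1)).ne'
        field_simp
      rw [hu, ht, aux a ha, aux b hb, ← mul_add, Real.rpow_sub_one (by positivity)]
      apply le_of_eq
      field_simp
  refine ⟨z, ⟨hz.trans_lt ENNReal.ofReal_lt_top, fun hp => ?_⟩, hz, ?_⟩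
  · have h1 := (hx.2 hp).const_smul ((u⁻¹ : ℝ) : 𝕜)
    have h2 := (hy.2 hp).const_smul ((t⁻¹ : ℝ) : 𝕜)
    rw [smul_zero, ← Nat.cofinite_eq_atTop] at h1 h2
    have h3 : Tendsto (Sum.elim (fun i => ((u⁻¹ : ℝ) : 𝕜) • x i)
        (fun i => ((t⁻¹ : ℝ) : 𝕜) • y i)) cofinite (𝓝 0) := by
      intro s hs
      have e1 := h1 hs
      have e2 := h2 hs
      simp only [mem_map, mem_cofinite] at e1 e2 ⊢
      refine ((e1.image Sum.inl).union (e2.image Sum.inr)).subset ?_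
      rintro (i | i) hi
      · exact Or.inl ⟨i, hi, rfl⟩
      · exact Or.inr ⟨i, hi, rfl⟩
    rw [← Nat.cofinite_eq_atTop]
    exact h3.comp e.symm.injective.tendsto_cofinite
  · rintro v ⟨α, hα, hv⟩ w ⟨β, hβ, hw⟩
    refine ⟨fun n => Sum.elim (fun i => ((u : ℝ) : 𝕜) • α i)
      (fun i => ((t : ℝ) : 𝕜) • β i) (e.symm n), ?_, ?_⟩
    · rw [pnorm_comp_equiv e.symm, ← ENNReal.ofReal_one]
      refine pnorm_sum_le (A := u) (B := t) hu0.le ht0.le zero_le_one ?_ ?_ ?_ ?_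
      · rw [pnorm_smul, ← ofReal_norm, RCLike.norm_ofReal, abs_of_pos hu0]
        exact mul_le_of_le_one_right' hα
      · rw [pnorm_smul, ← ofReal_norm, RCLike.norm_ofReal, abs_of_pos ht0]
        exact mul_le_of_le_one_right' hβ
      · intro h
        have h' : q.toReal = 0 := by rw [hq, h, ENNReal.toReal_top]
        have : u = 1 ∧ t = 1 := by rw [hu, ht, h', inv_zero, Real.rpow_zero, Real.rpow_zero]; simp
        exact ⟨this.1.le, this.2.le⟩
      · intro h
        have h0 := toReal_pos_of_fact q h
        rw [hu, ht, ← Real.rpow_mul (by positivity), ← Real.rpow_mul (by positivity),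
          inv_mul_cancel₀ h0.ne', Real.rpow_one, Real.rpow_one, Real.one_rpow]
        apply le_of_eq
        field_simp
    · have hsum : HasSum (fun k => Sum.elim (fun i => ((u : ℝ) : 𝕜) • α i)
          (fun i => ((t : ℝ) : 𝕜) • β i) k • Sum.elim (fun i => ((u⁻¹ : ℝ) : 𝕜) • x i)
          (fun i => ((t⁻¹ : ℝ) : 𝕜) • y i) k) (v + w) := by
        refine HasSum.sum ?_ ?_
        · convert hv using 2 with i
          have : ((u : ℝ) : 𝕜) ≠ 0 := by exact_mod_cast hu0.ne'
          simp only [Function.comp, Sum.elim_inl, smul_smul, smul_eq_mul, RCLike.ofReal_inv]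
          congr 1
          field_simp
        · convert hw using 2 with i
          have : ((t : ℝ) : 𝕜) ≠ 0 := by exact_mod_cast ht0.ne'
          simp only [Function.comp, Sum.elim_inr, smul_smul, smul_eq_mul, RCLike.ofReal_inv]
          congr 1
          field_simp
      exact (Equiv.hasSum_iff e.symm (f := fun k => Sum.elim (fun i => ((u : ℝ) : 𝕜) • α i)
          (fun i => ((t : ℝ) : 𝕜) • β i) k • Sum.elim (fun i => ((u⁻¹ : ℝ) : 𝕜) • x i)
          (fun i => ((t⁻¹ : ℝ) : 𝕜) • y i) k)).2 hsum

lemma smul_mem_hull {p : ℝ≥0∞} {x : ℕ → E} {v : E} (c : 𝕜) (hv : v ∈ hull 𝕜 p x) :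
    c • v ∈ hull 𝕜 p (fun n => c • x n) := by
  obtain ⟨α, hα, hs⟩ := hv
  refine ⟨α, hα, ?_⟩
  convert hs.const_smul c using 2 with n
  exact smul_comm _ _ _

lemma MemLpC0.smul {p : ℝ≥0∞} [Fact (1 ≤ p)] {x : ℕ → E} (c : 𝕜) (hx : MemLpC0 p x) :
    MemLpC0 p (fun n => c • x n) :=
  ⟨by rw [pnorm_smul]; exact ENNReal.mul_lt_top enorm_lt_top hx.1,
    fun hp => by simpa using (hx.2 hp).const_smul c⟩

lemma memLpC0_single {p : ℝ≥0∞} [Fact (1 ≤ p)] (v : E) :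
    MemLpC0 p (fun n : ℕ => if n = 0 then v else 0) :=
  ⟨by rw [pnorm_single]; exact enorm_lt_top, fun _ =>
    tendsto_const_nhds.congr' <| (eventually_gt_atTop 0).mono fun n hn => by simp [hn.ne']⟩

lemma smul_mem_hull_single {p : ℝ≥0∞} (c : 𝕜) (hc : ‖c‖ ≤ 1) (v : E) :
    c • v ∈ hull 𝕜 p (fun n : ℕ => if n = 0 then v else 0) := by
  refine ⟨fun n => if n = 0 then c else 0, ?_, ?_⟩
  · rw [pnorm_single, ← ofReal_norm]
    exact ENNReal.ofReal_le_one.2 hc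
  · convert hasSum_single (f := fun n : ℕ => (if n = 0 then c else 0) • (if n = 0 then v else 0))
      0 (by intro n hn; simp [hn]) using 1
    simp

end hull

/-! ### The space `C_p(Ω, X)` -/

/-- The subspace of `C(Ω, X)` of all `f` with `p`-compact range. -/
def cpSubmodule (𝕜 : Type*) [RCLike 𝕜] (p : ℝ≥0∞) [Fact (1 ≤ p)] (Ω X : Type*)
    [TopologicalSpace Ω] [NormedAddCommGroup X] [NormedSpace 𝕜 X] : Submodule 𝕜 C(Ω, X) where
  carrier := {f | IsPCompact 𝕜 p (Set.range f)}
  zero_mem' := by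
    refine ⟨_, memLpC0_single 0, ?_⟩
    rintro _ ⟨ω, rfl⟩
    simpa using smul_mem_hull_single (𝕜 := 𝕜) (p := p) 0 (by simp) (0 : X)
  add_mem' := by
    rintro f g ⟨x, hx, hfx⟩ ⟨y, hy, hgy⟩
    obtain ⟨z, hz, -, h⟩ := exists_hull_add (𝕜 := 𝕜)
      (a := (pnorm p x).toReal + 1) (b := (pnorm p y).toReal + 1) (by positivity) (by positivity)
      hx hy
      ((ENNReal.le_ofReal_iff_toReal_le hx.1.ne (by positivity)).2 (by linarith))
      ((ENNReal.le_ofReal_iff_toReal_le hy.1.ne (by positivity)).2 (by linarith))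
    refine ⟨z, hz, ?_⟩
    rintro _ ⟨ω, rfl⟩
    exact h _ (hfx ⟨ω, rfl⟩) _ (hgy ⟨ω, rfl⟩)
  smul_mem' := by
    rintro c f ⟨x, hx, hfx⟩
    refine ⟨_, hx.smul c, ?_⟩
    rintro _ ⟨ω, rfl⟩
    exact smul_mem_hull c (hfx ⟨ω, rfl⟩)

/-- The space `C_p(Ω, X)` of `p`-continuous functions. It does not carry the supremum norm, but the
norm `f ↦ inf ‖(xₙ)‖_p` defined below. -/
def Cp (𝕜 : Type*) [RCLike 𝕜] (p : ℝ≥0∞) [Fact (1 ≤ p)] (Ω X : Type*)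
    [TopologicalSpace Ω] [NormedAddCommGroup X] [NormedSpace 𝕜 X] : Type _ :=
  ↥(cpSubmodule 𝕜 p Ω X)

section Cp

variable {𝕜 : Type*} [RCLike 𝕜] {p : ℝ≥0∞} [Fact (1 ≤ p)] {Ω X : Type*}
    [TopologicalSpace Ω] [NormedAddCommGroup X] [NormedSpace 𝕜 X]

instance : AddCommGroup (Cp 𝕜 p Ω X) := inferInstanceAs (AddCommGroup ↥(cpSubmodule 𝕜 p Ω X))

instance : Module 𝕜 (Cp 𝕜 p Ω X) := inferInstanceAs (Module 𝕜 ↥(cpSubmodule 𝕜 p Ω X))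

/-- The underlying continuous function. -/
def Cp.toC (f : Cp 𝕜 p Ω X) : C(Ω, X) := Subtype.val f

/-- `‖f‖ = inf ‖(xₙ)‖_p` over all `(xₙ)` in `ℓ_p(X)` (in `c_0(X)` if `p = ∞`) such that
`f(Ω) ⊆ { ∑ αₙ xₙ : (αₙ) in the closed unit ball of ℓ_{p'} }`. -/
instance : Norm (Cp 𝕜 p Ω X) :=
  ⟨fun f => sInf {r : ℝ | ∃ x : ℕ → X, MemLpC0 p x ∧ Set.range f.toC ⊆ hull 𝕜 p x ∧
    r = (pnorm p x).toReal}⟩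

lemma Cp.norm_le (f : Cp 𝕜 p Ω X) {x : ℕ → X} (hx : MemLpC0 p x)
    (h : Set.range f.toC ⊆ hull 𝕜 p x) : ‖f‖ ≤ (pnorm p x).toReal :=
  csInf_le ⟨0, by rintro _ ⟨x, -, -, rfl⟩; positivity⟩ ⟨x, hx, h, rfl⟩

lemma Cp.norm_nonneg' (f : Cp 𝕜 p Ω X) : 0 ≤ ‖f‖ :=
  Real.sInf_nonneg (by rintro _ ⟨x, -, -, rfl⟩; positivity)

lemma Cp.exists_lt (f : Cp 𝕜 p Ω X) {r : ℝ} (hr : ‖f‖ < r) :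
    ∃ x : ℕ → X, MemLpC0 p x ∧ Set.range f.toC ⊆ hull 𝕜 p x ∧ pnorm p x ≤ ENNReal.ofReal r := by
  obtain ⟨x, hx, h⟩ := f.2
  have hne : {r : ℝ | ∃ x : ℕ → X, MemLpC0 p x ∧ Set.range f.toC ⊆ hull 𝕜 p x ∧
      r = (pnorm p x).toReal}.Nonempty := ⟨_, x, hx, h, rfl⟩
  obtain ⟨_, ⟨y, hy, hfy, rfl⟩, hlt⟩ := exists_lt_of_csInf_lt hne hr
  exact ⟨y, hy, hfy, (ENNReal.le_ofReal_iff_toReal_le hy.1.ne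
    (f.norm_nonneg'.trans hr.le)).2 hlt.le⟩

lemma Cp.norm_smul_le' (c : 𝕜) (f : Cp 𝕜 p Ω X) : ‖c • f‖ ≤ ‖c‖ * ‖f‖ := by
  refine le_of_forall_pos_le_add fun ε hε => ?_
  obtain ⟨x, hx, hfx, hlt⟩ := f.exists_lt (r := ‖f‖ + ε / (‖c‖ + 1)) (by simp; positivity)
  have h1 : ‖c • f‖ ≤ (pnorm p (fun n => c • x n)).toReal := by
    refine Cp.norm_le _ (hx.smul c) ?_
    rintro _ ⟨ω, rfl⟩
    exact smul_mem_hull c (hfx ⟨ω, rfl⟩)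
  rw [pnorm_smul, ENNReal.toReal_mul, toReal_enorm] at h1
  have h2 : (pnorm p x).toReal ≤ ‖f‖ + ε / (‖c‖ + 1) :=
    ENNReal.toReal_le_of_le_ofReal (add_nonneg f.norm_nonneg' (by positivity)) hlt
  have h3 : ‖c‖ * (ε / (‖c‖ + 1)) ≤ ε := by
    rw [mul_div_assoc', div_le_iff₀ (by positivity)]
    nlinarith [norm_nonneg c]
  nlinarith [norm_nonneg c, mul_le_mul_of_nonneg_left h2 (norm_nonneg c)]

lemma Cp.core : NormedSpace.Core 𝕜 (Cp 𝕜 p Ω X) where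
  norm_nonneg := Cp.norm_nonneg'
  norm_smul c f := by
    refine le_antisymm (Cp.norm_smul_le' c f) ?_
    by_cases hc : c = 0
    · simpa [hc] using Cp.norm_nonneg' _
    · have h := Cp.norm_smul_le' c⁻¹ (c • f)
      rw [inv_smul_smul₀ hc, norm_inv] at h
      have := norm_pos_iff.2 hc
      rwa [inv_mul_eq_div, le_div_iff₀ this, mul_comm] at h
  norm_triangle f g := by
    refine le_of_forall_pos_le_add fun ε hε => ?_
    obtain ⟨x, hx, hfx, hlt⟩ := f.exists_lt (r := ‖f‖ + ε / 2) (by linarith)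
    obtain ⟨y, hy, hgy, hlt'⟩ := g.exists_lt (r := ‖g‖ + ε / 2) (by linarith)
    have hf := f.norm_nonneg'
    have hg := g.norm_nonneg'
    obtain ⟨z, hz, hzn, h⟩ := exists_hull_add (𝕜 := 𝕜) (by positivity) (by positivity)
      hx hy hlt hlt'
    have h1 : ‖f + g‖ ≤ (pnorm p z).toReal := by
      refine Cp.norm_le _ hz ?_
      rintro _ ⟨ω, rfl⟩
      exact h _ (hfx ⟨ω, rfl⟩) _ (hgy ⟨ω, rfl⟩)
    have h2 := ENNReal.toReal_le_of_le_ofReal (by positivity) hzn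
    linarith
  norm_eq_zero_iff f := by
    constructor
    · intro h
      refine Subtype.ext (ContinuousMap.ext fun ω => norm_le_zero_iff.1 ?_)
      refine le_of_forall_pos_le_add fun ε hε => ?_
      obtain ⟨x, hx, hfx, hlt⟩ := f.exists_lt (r := ε) (by linarith)
      have h1 := (enorm_le_of_mem_hull (hfx ⟨ω, rfl⟩)).trans hlt
      rw [← ofReal_norm, ENNReal.ofReal_le_ofReal_iff hε.le] at h1
      linarith [show ‖f.1 ω‖ ≤ ε from h1]
    · rintro rfl
      have h := Cp.norm_smul_le' (0 : 𝕜) (0 : Cp 𝕜 p Ω X)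
      rw [smul_zero, norm_zero, zero_mul] at h
      exact le_antisymm h (Cp.norm_nonneg' _)

instance : NormedAddCommGroup (Cp 𝕜 p Ω X) := NormedAddCommGroup.ofCore Cp.core

instance : NormedSpace 𝕜 (Cp 𝕜 p Ω X) := NormedSpace.ofCore Cp.core

end Cp

section tmul

variable {𝕜 : Type*} [RCLike 𝕜] {Ω X Y : Type*} [TopologicalSpace Ω]
    [NormedAddCommGroup X] [NormedSpace 𝕜 X] [NormedAddCommGroup Y] [NormedSpace 𝕜 Y]

/-- The function `φ x : ω ↦ φ(ω) x` in `C(Ω, X)`. -/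
def elem (φ : C(Ω, 𝕜)) (x : X) : C(Ω, X) := ⟨fun ω => φ ω • x, by fun_prop⟩

lemma elem_mem [CompactSpace Ω] (p : ℝ≥0∞) [Fact (1 ≤ p)] (φ : C(Ω, 𝕜)) (x : X) :
    elem φ x ∈ cpSubmodule 𝕜 p Ω X := by
  refine ⟨_, memLpC0_single (((‖φ‖ + 1 : ℝ) : 𝕜) • x), ?_⟩
  rintro _ ⟨ω, rfl⟩
  have h0 : (0 : ℝ) < ‖φ‖ + 1 := by positivity
  have h1 : ((‖φ‖ + 1 : ℝ) : 𝕜) ≠ 0 := by exact_mod_cast h0.ne'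
  convert smul_mem_hull_single (𝕜 := 𝕜) (p := p) (φ ω * ((‖φ‖ + 1 : ℝ) : 𝕜)⁻¹) ?_
    (((‖φ‖ + 1 : ℝ) : 𝕜) • x) using 1
  · rw [smul_smul, inv_mul_cancel_right₀ h1]; rfl
  · rw [norm_mul, norm_inv, RCLike.norm_ofReal, abs_of_pos h0, ← div_eq_mul_inv,
      div_le_one h0]
    linarith [φ.norm_coe_le_norm ω]

/-- The function `φ x : ω ↦ φ(ω) x` as an element of `C_p(Ω, X)`. -/
def Cp.elem [CompactSpace Ω] (p : ℝ≥0∞) [Fact (1 ≤ p)] (φ : C(Ω, 𝕜)) (x : X) : Cp 𝕜 p Ω X :=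
  ⟨PCont.elem φ x, elem_mem p φ x⟩

end tmul

/-! ### The conditions -/

section conditions

variable {𝕜 : Type*} [RCLike 𝕜] {Ω X Y : Type*} [TopologicalSpace Ω] [CompactSpace Ω]
    [NormedAddCommGroup X] [NormedSpace 𝕜 X] [NormedAddCommGroup Y] [NormedSpace 𝕜 Y]

/-- `S = U^#` for some `U ∈ L(C_p(Ω, X), Y)`, where `(U^# φ) x = U (φ x)`. -/
def IsAssocCp (p : ℝ≥0∞) [Fact (1 ≤ p)] (S : C(Ω, 𝕜) →L[𝕜] X →L[𝕜] Y) : Prop :=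
  ∃ U : Cp 𝕜 p Ω X →L[𝕜] Y, ∀ (φ : C(Ω, 𝕜)) (x : X), S φ x = U (Cp.elem p φ x)

/-- `S = U^#` for some `U ∈ L(C(Ω, X), Y)`, where `C(Ω, X)` has the supremum norm. -/
def IsAssocC (S : C(Ω, 𝕜) →L[𝕜] X →L[𝕜] Y) : Prop :=
  ∃ U : C(Ω, X) →L[𝕜] Y, ∀ (φ : C(Ω, 𝕜)) (x : X), S φ x = U (elem φ x)

/-- The inequality for all finite systems. -/
def FiniteIneq (q : ℝ≥0∞) (S : C(Ω, 𝕜) →L[𝕜] X →L[𝕜] Y) : Prop :=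
  ∃ c : ℝ≥0, 0 < c ∧ ∀ (n : ℕ) (x : Fin n → X) (φ : Fin n → C(Ω, 𝕜)),
    wnorm 𝕜 q (fun i => S (φ i) (x i)) ≤ c * pnorm ∞ x * wnorm 𝕜 q φ

/-- The inequality for all tails of infinite sequences. -/
def TailIneq (q : ℝ≥0∞) (S : C(Ω, 𝕜) →L[𝕜] X →L[𝕜] Y) : Prop :=
  ∃ c : ℝ≥0, 0 < c ∧ ∀ (x : ℕ → X) (φ : ℕ → C(Ω, 𝕜)),
    pnorm ∞ x < ∞ → WeaklySummable 𝕜 q φ → ∀ n : ℕ,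
      wnorm 𝕜 q (fun i => S (φ (n + i)) (x (n + i))) ≤
        c * pnorm ∞ (fun i => x (n + i)) * wnorm 𝕜 q (fun i => φ (n + i))

/-- `ℓ_∞(X)` and `ℓ_q^w(C(Ω))` are mapped into `ℓ_q^w(Y)`. -/
def MapsBddWeak (q : ℝ≥0∞) (S : C(Ω, 𝕜) →L[𝕜] X →L[𝕜] Y) : Prop :=
  ∀ (x : ℕ → X) (φ : ℕ → C(Ω, 𝕜)), pnorm ∞ x < ∞ → WeaklySummable 𝕜 q φ →
    WeaklySummable 𝕜 q (fun i => S (φ i) (x i))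

/-- `c_0(X)` and `ℓ_q^w(C(Ω))` are mapped into `ℓ_q^u(Y)`. -/
def MapsC0Weak (q : ℝ≥0∞) (S : C(Ω, 𝕜) →L[𝕜] X →L[𝕜] Y) : Prop :=
  ∀ (x : ℕ → X) (φ : ℕ → C(Ω, 𝕜)), Tendsto x atTop (𝓝 0) → WeaklySummable 𝕜 q φ →
    UncondSummable 𝕜 q (fun i => S (φ i) (x i))

/-- `ℓ_∞(X)` and `ℓ_q^u(C(Ω))` are mapped into `ℓ_q^u(Y)`. -/
def MapsBddUncond (q : ℝ≥0∞) (S : C(Ω, 𝕜) →L[𝕜] X →L[𝕜] Y) : Prop :=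
  ∀ (x : ℕ → X) (φ : ℕ → C(Ω, 𝕜)), pnorm ∞ x < ∞ → UncondSummable 𝕜 q φ →
    UncondSummable 𝕜 q (fun i => S (φ i) (x i))

end conditions

end PCont

end

open PCont

/-!
Write `q = p'`. Two principles carry the proof.

*Duality.* By Hölder's inequality and its converse (`pnorm_le_of_dual`), the weak norm
`‖(xᵢ)‖_q^w` is the least `C` with `‖∑ aᵢ xᵢ‖ ≤ C` for all finite sums with coefficients in the
unit ball of `ℓ_p` (`wnorm_le_of_dual`, `enorm_sum_smul_le`). Hence weak norms are determined by finite
subsystems, and the inequality for finite systems extends to arbitrary systems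
(`wnorm_apply_le_of_finite`). Applied to tails, it gives all the conditions on sequences.
Conversely, if it fails, suitably scaled finite counterexamples are strung together to a null
sequence `(xᵢ)` and a sequence `(φᵢ)` in `ℓ_q^u(C(Ω))` for which `((S φᵢ) xᵢ)` has infinite weak norm
(`finiteIneq_of_forall_weaklySummable`), so it is not in `ℓ_q^w(Y)` by uniform boundedness
(`weaklySummable_iff`). This refutes each of the conditions on sequences at once.

*Partitions of unity.* A function `f` with range in the hull of `(xₙ)` is approximated by
`∑ ψ_a f(a)` for fine partitions of unity `(ψ_a)`. If `f(a) = ∑ αₙ(a) xₙ`, this function equals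
`∑ φₙ xₙ` with `φₙ = ∑ ψ_a αₙ(a)`; at every point, the sequence `(φₙ)` is a convex combination of
elements of the unit ball of `ℓ_q`, so that `‖(φₙ)‖_q^w ≤ 1`. The inequality for finite systems
therefore bounds `∑ (S ψ_a) f(a)` by `c ‖(xₙ)‖_p`, and in the limit it bounds the lift of `S` to
`C(Ω) ⊗ X` by the norm of `C_p(Ω, X)` (`norm_tensorLift_le_norm_tensorToCp`). For the extension to
all of `C_p(Ω, X)` one needs the density of `C(Ω) ⊗ X` (`denseRange_tensorToCp`). It rests on the
compactness of the balls of `ℓ_q` for coordinatewise convergence: points of the hull of `(xₙ)` that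
are close in norm differ by an element of a hull of small norm (`exists_sub_mem_hull_of_dist_lt`).
For `C(Ω, X)` and `q = 1` the partition `(ψ_a)` itself has weak norm at most one, which yields the
bound by the supremum norm directly.

In the other direction, `U ∈ L(C_p(Ω, X), Y)` gives the inequality because `∑ φᵢ xᵢ` has norm at most
`‖(xᵢ)‖_p ‖(φᵢ)‖_q^w` in `C_p(Ω, X)` (`enorm_sum_elem_le`); and every operator on `C(Ω, X)` restricts
to an operator on `C_p(Ω, X)`.
-/

namespace PCont

open scoped TensorProduct

/-! ### Norms of systems and duality -/

section pnorm

variable {ι κ E F : Type*} [NormedAddCommGroup E] [NormedAddCommGroup F] {p : ℝ≥0∞}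

lemma enorm_le_pnorm [Fact (1 ≤ p)] (x : ι → E) (i : ι) : ‖x i‖ₑ ≤ pnorm p x := by
  by_cases hp : p = ∞
  · subst hp
    rw [pnorm_top]
    exact le_iSup (fun i => ‖x i‖ₑ) i
  · have h0 := toReal_pos_of_fact p hp
    rw [← ENNReal.rpow_le_rpow_iff h0, pnorm_rpow hp]
    exact ENNReal.le_tsum i

/-- A bound for `pnorm p x` may be checked on finite subsystems. -/
lemma pnorm_le_of_finset [Fact (1 ≤ p)] {x : ι → E} {C : ℝ≥0∞} (h1 : ∀ i, ‖x i‖ₑ ≤ C)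
    (h2 : p ≠ ∞ → ∀ s : Finset ι, (∑ i ∈ s, ‖x i‖ₑ ^ p.toReal) ^ (1 / p.toReal) ≤ C) :
    pnorm p x ≤ C := by
  by_cases hp : p = ∞
  · subst hp
    rw [pnorm_top]
    exact iSup_le h1
  · have h0 := toReal_pos_of_fact p hp
    rw [← ENNReal.rpow_le_rpow_iff h0, pnorm_rpow hp, ENNReal.tsum_eq_iSup_sum]
    refine iSup_le fun s => ?_
    have := (ENNReal.rpow_le_rpow_iff h0).2 (h2 hp s)
    rwa [← ENNReal.rpow_mul, one_div_mul_cancel h0.ne', ENNReal.rpow_one] at this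

lemma pnorm_top_le_iff {x : ι → E} {C : ℝ≥0∞} : pnorm ∞ x ≤ C ↔ ∀ i, ‖x i‖ₑ ≤ C := by
  rw [pnorm_top, iSup_le_iff]

/-- Comparison along an injection: the system `x` is dominated by a subsystem of `y`. -/
lemma pnorm_le_pnorm_of_injective [Fact (1 ≤ p)] {x : ι → E} {y : κ → F} {e : ι → κ}
    (he : Function.Injective e) (h : ∀ i, ‖x i‖ₑ ≤ ‖y (e i)‖ₑ) : pnorm p x ≤ pnorm p y := by
  by_cases hp : p = ∞
  · subst hp
    exact pnorm_top_le_iff.2 fun i => (h i).trans (enorm_le_pnorm y _)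
  · rw [pnorm_of_ne_top hp, pnorm_of_ne_top hp]
    gcongr
    refine le_trans (ENNReal.tsum_le_tsum fun i => ?_)
      (ENNReal.tsum_comp_le_tsum_of_injective he (fun k => ‖y k‖ₑ ^ p.toReal))
    gcongr
    exact h i

lemma pnorm_mono [Fact (1 ≤ p)] {x : ι → E} {y : ι → F} (h : ∀ i, ‖x i‖ₑ ≤ ‖y i‖ₑ) :
    pnorm p x ≤ pnorm p y :=
  pnorm_le_pnorm_of_injective Function.injective_id h

/-- Members that vanish do not contribute to the norm. -/
lemma pnorm_le_pnorm_comp [Fact (1 ≤ p)] {e : ι → κ} (he : Function.Injective e) {y : κ → E}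
    (hy : ∀ k ∉ Set.range e, y k = 0) : pnorm p y ≤ pnorm p (fun i => y (e i)) := by
  by_cases hp : p = ∞
  · subst hp
    refine pnorm_top_le_iff.2 fun k => ?_
    by_cases hk : k ∈ Set.range e
    · obtain ⟨i, rfl⟩ := hk
      exact enorm_le_pnorm (fun i => y (e i)) i
    · simp [hy k hk]
  · have h0 := toReal_pos_of_fact p hp
    rw [pnorm_of_ne_top hp, pnorm_of_ne_top hp,
      he.tsum_eq (f := fun k => ‖y k‖ₑ ^ p.toReal)]
    intro k hk
    by_contra h
    exact hk (by simp [hy k h, h0])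

lemma one_le_toReal [h : Fact (1 ≤ p)] (hp : p ≠ ∞) : 1 ≤ p.toReal := by
  simpa using ENNReal.toReal_mono hp h.out

/-- Minkowski's inequality. -/
lemma pnorm_add_le [Fact (1 ≤ p)] (x y : ι → E) :
    pnorm p (fun i => x i + y i) ≤ pnorm p x + pnorm p y := by
  refine pnorm_le_of_finset (fun i => ?_) fun hp s => ?_
  · exact (enorm_add_le _ _).trans (add_le_add (enorm_le_pnorm x i) (enorm_le_pnorm y i))
  · have h1 := one_le_toReal hp
    rw [pnorm_of_ne_top hp, pnorm_of_ne_top hp]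
    calc (∑ i ∈ s, ‖x i + y i‖ₑ ^ p.toReal) ^ (1 / p.toReal)
        ≤ (∑ i ∈ s, (‖x i‖ₑ + ‖y i‖ₑ) ^ p.toReal) ^ (1 / p.toReal) := by
          gcongr; exact enorm_add_le _ _
      _ ≤ _ := ENNReal.Lp_add_le s _ _ h1
      _ ≤ _ := by gcongr <;> exact ENNReal.sum_le_tsum s

lemma pnorm_zero [Fact (1 ≤ p)] : pnorm p (fun _ : ι => (0 : E)) = 0 :=
  le_antisymm ((pnorm_le_pnorm_comp (ι := Empty) (e := Empty.elim) (fun a => a.elim)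
    (fun _ _ => rfl)).trans (by unfold pnorm; split_ifs with h <;>
      simp [toReal_pos_of_fact p, h])) zero_le

lemma pnorm_finset_sum_le [Fact (1 ≤ p)] (s : Finset κ) (x : κ → ι → E) :
    pnorm p (fun i => ∑ k ∈ s, x k i) ≤ ∑ k ∈ s, pnorm p (x k) := by
  classical
  induction s using Finset.induction_on with
  | empty => simp [pnorm_zero]
  | insert k s hk ih =>
    simp only [Finset.sum_insert hk]
    exact (pnorm_add_le _ _).trans (by gcongr)

lemma conjExponent_one : ENNReal.conjExponent 1 = ∞ := by simp [ENNReal.conjExponent]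

lemma conjExponent_top : ENNReal.conjExponent ∞ = 1 := by simp [ENNReal.conjExponent]

lemma conjExponent_ne_top [hp : Fact (1 ≤ p)] (h : p ≠ 1) : p.conjExponent ≠ ∞ := by
  have : p - 1 ≠ 0 := (tsub_pos_of_lt (lt_of_le_of_ne hp.out h.symm)).ne'
  simp [ENNReal.conjExponent, this]

lemma toReal_holderConjugate [Fact (1 ≤ p)] (h1 : p ≠ 1) (h2 : p ≠ ∞) :
    p.toReal.HolderConjugate p.conjExponent.toReal :=
  ENNReal.HolderConjugate.toReal_of_ne_top (p := p) (q := p.conjExponent) h2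
    (conjExponent_ne_top h1)

/-- Hölder's inequality on a finite set of indices. -/
lemma sum_enorm_mul_le [Fact (1 ≤ p)] (s : Finset ι) (x : ι → E) (y : ι → F) :
    ∑ i ∈ s, ‖x i‖ₑ * ‖y i‖ₑ ≤ pnorm p x * pnorm p.conjExponent y := by
  by_cases h1 : p = 1
  · subst h1
    rw [conjExponent_one, pnorm_of_ne_top (by simp)]
    simp only [ENNReal.toReal_one, ENNReal.rpow_one, div_one]
    refine le_trans ?_ (mul_le_mul_left (ENNReal.sum_le_tsum s) _)
    rw [Finset.sum_mul]
    gcongr with i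
    exact pnorm_top_le_iff.1 le_rfl i
  by_cases h2 : p = ∞
  · subst h2
    rw [conjExponent_top, pnorm_of_ne_top ENNReal.one_ne_top]
    simp only [ENNReal.toReal_one, ENNReal.rpow_one, div_one]
    refine le_trans ?_ (mul_le_mul_right (ENNReal.sum_le_tsum s) _)
    rw [Finset.mul_sum]
    gcongr with i
    exact pnorm_top_le_iff.1 le_rfl i
  refine (ENNReal.inner_le_Lp_mul_Lq s _ _ (toReal_holderConjugate h1 h2)).trans ?_
  rw [pnorm_of_ne_top (conjExponent_ne_top h1), pnorm_of_ne_top h2]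
  gcongr <;> exact ENNReal.sum_le_tsum s

lemma exists_norm_le_one_mul_eq_norm {𝕜 : Type*} [RCLike 𝕜] (z : 𝕜) :
    ∃ u : 𝕜, ‖u‖ ≤ 1 ∧ u * z = ((‖z‖ : ℝ) : 𝕜) := by
  by_cases hz : z = 0
  · exact ⟨0, by simp, by simp [hz]⟩
  · have h : ((‖z‖ : ℝ) : 𝕜) ≠ 0 := by simpa using hz
    refine ⟨(starRingEnd 𝕜) z / ((‖z‖ : ℝ) : 𝕜), ?_, ?_⟩
    · simp [div_self (norm_ne_zero_iff.2 hz)]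
    · rw [div_mul_eq_mul_div, RCLike.conj_mul, sq, mul_div_assoc, div_self h, mul_one]

/-- The converse of Hölder's inequality: the norm of `ℓ_{p'}` is computed by finite sections of
the unit ball of `ℓ_p`. -/
lemma pnorm_le_of_dual {𝕜 : Type*} [RCLike 𝕜] [Fact (1 ≤ p)] {b : ι → 𝕜} {C : ℝ≥0∞}
    (h : ∀ (s : Finset ι) (a : ι → 𝕜), pnorm p a ≤ 1 → ‖∑ i ∈ s, a i * b i‖ₑ ≤ C) :
    pnorm p.conjExponent b ≤ C := by
  classical
  refine pnorm_le_of_finset (fun i => ?_) fun hq s => ?_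
  · simpa using h {i} (fun j => if j = i then 1 else 0) (by rw [pnorm_single]; simp)
  choose u hu hub using fun i => exists_norm_le_one_mul_eq_norm (b i)
  -- It suffices to pair `‖b‖` with nonnegative coefficients `g` supported on `s`.
  have key (g : ι → ℝ≥0) (hg : pnorm p (fun i => if i ∈ s then ((g i : ℝ) : 𝕜) else 0) ≤ 1) :
      ((∑ i ∈ s, ‖b i‖₊ * g i : ℝ≥0) : ℝ≥0∞) ≤ C := by
    have := h s (fun i => (if i ∈ s then ((g i : ℝ) : 𝕜) else 0) * u i) ?_
    · refine le_trans (le_of_eq ?_) this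
      rw [Finset.sum_congr rfl (g := fun i => (((‖b i‖₊ * g i : ℝ≥0) : ℝ) : 𝕜))
        (fun i hi => by rw [if_pos hi, mul_assoc, hub]; push_cast; ring)]
      rw [← RCLike.ofReal_sum, ← NNReal.coe_sum, ← ofReal_norm, RCLike.norm_ofReal,
        NNReal.abs_eq, ENNReal.ofReal_coe_nnreal]
    · refine (pnorm_mono fun i => ?_).trans hg
      rw [enorm_mul]
      refine mul_le_of_le_one_right' ?_
      rw [← ofReal_norm]
      exact ENNReal.ofReal_le_one.2 (hu i)
  have hen (i : ι) : ‖(if i ∈ s then ((1 : ℝ) : 𝕜) else 0)‖ₑ ≤ 1 := by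
    split_ifs <;> simp
  by_cases h2 : p = ∞
  · subst h2
    rw [conjExponent_top]
    have := key (fun _ => 1) (pnorm_top_le_iff.2 (by simpa using hen))
    simpa [enorm_eq_nnnorm] using this
  have h1 : p ≠ 1 := by
    rintro rfl
    exact hq conjExponent_one
  have hc := toReal_holderConjugate h1 h2
  obtain ⟨g, hg, hgs⟩ := (NNReal.isGreatest_Lp s (fun i => ‖b i‖₊) hc.symm).1
  have h0 := toReal_pos_of_fact p h2
  have h3 := toReal_pos_of_fact _ hq
  have hval : (∑ i ∈ s, ‖b i‖ₑ ^ p.conjExponent.toReal) ^ (1 / p.conjExponent.toReal)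
      = ((∑ i ∈ s, ‖b i‖₊ * g i : ℝ≥0) : ℝ≥0∞) := by
    rw [show (∑ i ∈ s, ‖b i‖₊ * g i : ℝ≥0) = _ from hgs,
      ENNReal.coe_rpow_of_nonneg _ (by positivity)]
    simp [enorm_eq_nnnorm, ENNReal.coe_rpow_of_nonneg _ h3.le]
  rw [hval]
  refine key g ?_
  rw [← ENNReal.rpow_le_rpow_iff h0, pnorm_rpow h2, ENNReal.one_rpow,
    tsum_eq_sum (s := s) (fun i hi => by simp [hi, h0])]
  have hg' : ((∑ i ∈ s, g i ^ p.toReal : ℝ≥0) : ℝ≥0∞) ≤ 1 := by exact_mod_cast hg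
  refine le_trans (le_of_eq ?_) hg'
  push_cast
  refine Finset.sum_congr rfl fun i hi => ?_
  rw [if_pos hi, ENNReal.coe_rpow_of_nonneg _ h0.le, ← ofReal_norm, RCLike.norm_ofReal,
    NNReal.abs_eq, ENNReal.ofReal_coe_nnreal]

/-- The tails of a sequence in `ℓ_p(E)`, or in `c_0(E)` if `p = ∞`, are small. -/
lemma MemLpC0.tendsto_tail [Fact (1 ≤ p)] {x : ℕ → E} (hx : MemLpC0 p x) :
    Tendsto (fun N => pnorm p (fun n => if n < N then 0 else x n)) atTop (𝓝 0) := by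
  by_cases hp : p = ∞
  · subst hp
    rw [ENNReal.tendsto_atTop_zero]
    intro ε hε
    have h := (hx.2 rfl).enorm
    rw [enorm_zero, ENNReal.tendsto_atTop_zero] at h
    obtain ⟨N, hN⟩ := h ε hε
    refine ⟨N, fun M hM => pnorm_top_le_iff.2 fun n => ?_⟩
    split_ifs with hn
    · simp
    · exact hN n (by omega)
  · have h0 := toReal_pos_of_fact p hp
    have hs : ∑' n, ‖x n‖ₑ ^ p.toReal ≠ ∞ := by
      rw [← pnorm_rpow hp]
      exact (ENNReal.rpow_lt_top_of_nonneg h0.le hx.1.ne).ne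
    have h := ENNReal.tendsto_sum_nat_add _ hs
    have h' := h.ennrpow_const (1 / p.toReal)
    rw [ENNReal.zero_rpow_of_pos (by positivity)] at h'
    refine h'.congr fun N => ?_
    rw [pnorm_of_ne_top hp]
    congr 1
    rw [← ENNReal.summable.sum_add_tsum_nat_add' (k := N)
      (f := fun n => ‖if n < N then 0 else x n‖ₑ ^ p.toReal), Finset.sum_eq_zero, zero_add]
    · simp
    · intro n hn
      simp [Finset.mem_range.1 hn, h0]

end pnorm

/-! ### Weak norms -/

section wnorm

variable {𝕜 ι κ E : Type*} [RCLike 𝕜] [NormedAddCommGroup E] [NormedSpace 𝕜 E] {p q : ℝ≥0∞}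

lemma wnorm_le_iff {x : ι → E} {C : ℝ≥0∞} :
    wnorm 𝕜 q x ≤ C ↔ ∀ f : StrongDual 𝕜 E, ‖f‖ ≤ 1 → pnorm q (fun i => f (x i)) ≤ C := by
  simp [wnorm]

/-- The weak norm of `ℓ_{p'}^w(E)` is the norm of the operator `a ↦ ∑ aᵢ xᵢ` on `ℓ_p`. -/
lemma wnorm_le_of_dual [Fact (1 ≤ p)] {x : ι → E} {C : ℝ≥0∞}
    (h : ∀ (s : Finset ι) (a : ι → 𝕜), pnorm p a ≤ 1 → ‖∑ i ∈ s, a i • x i‖ₑ ≤ C) :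
    wnorm 𝕜 p.conjExponent x ≤ C := by
  refine wnorm_le_iff.2 fun f hf => pnorm_le_of_dual fun s a ha => le_trans ?_ (h s a ha)
  have : ∑ i ∈ s, a i * f (x i) = f (∑ i ∈ s, a i • x i) := by simp
  rw [this, ← ofReal_norm, ← ofReal_norm]
  exact ENNReal.ofReal_le_ofReal ((f.le_of_opNorm_le hf _).trans (one_mul _).le)

lemma enorm_sum_smul_le [Fact (1 ≤ p)] (s : Finset ι) (a : ι → 𝕜) (x : ι → E) :
    ‖∑ i ∈ s, a i • x i‖ₑ ≤ pnorm p a * wnorm 𝕜 p.conjExponent x := by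
  obtain ⟨f, hf, hfv⟩ := exists_dual_vector'' 𝕜 (∑ i ∈ s, a i • x i)
  calc ‖∑ i ∈ s, a i • x i‖ₑ = ‖f (∑ i ∈ s, a i • x i)‖ₑ := by
        rw [hfv, ← ofReal_norm, ← ofReal_norm, RCLike.norm_ofReal, abs_norm]
    _ = ‖∑ i ∈ s, a i * f (x i)‖ₑ := by simp
    _ ≤ ∑ i ∈ s, ‖a i‖ₑ * ‖f (x i)‖ₑ := by
        refine (enorm_sum_le _ _).trans (le_of_eq ?_)
        simp [enorm_mul]
    _ ≤ pnorm p a * pnorm p.conjExponent (fun i => f (x i)) := sum_enorm_mul_le _ _ _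
    _ ≤ _ := by
        gcongr
        exact wnorm_le_iff.1 le_rfl f hf

lemma enorm_le_wnorm [Fact (1 ≤ p)] (x : ι → E) (i : ι) :
    ‖x i‖ₑ ≤ wnorm 𝕜 p.conjExponent x := by
  classical
  have := enorm_sum_smul_le (p := p) {i} (fun j => if j = i then (1 : 𝕜) else 0) x
  rw [pnorm_single] at this
  simpa using this

lemma pnorm_apply_le [Fact (1 ≤ q)] (f : StrongDual 𝕜 E) (x : ι → E) :
    pnorm q (fun i => f (x i)) ≤ ‖f‖ₑ * wnorm 𝕜 q x := by
  by_cases hf : f = 0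
  · subst hf
    have : pnorm q (fun i : ι => (0 : 𝕜) • (0 : 𝕜)) = ‖(0 : 𝕜)‖ₑ * _ := pnorm_smul 0 _
    simp only [smul_zero, enorm_zero, zero_mul] at this
    simp [this]
  · have h0 : ((‖f‖ : ℝ) : 𝕜) ≠ 0 := by simpa using hf
    have h1 : ‖(((‖f‖ : ℝ) : 𝕜)⁻¹ • f)‖ ≤ 1 := by
      simp [norm_smul, inv_mul_cancel₀ (norm_ne_zero_iff.2 hf)]
    have h2 := wnorm_le_iff.1 (le_refl (wnorm 𝕜 q x)) _ h1
    have h3 := pnorm_smul (p := q) ((‖f‖ : ℝ) : 𝕜) (fun i => (((‖f‖ : ℝ) : 𝕜)⁻¹ • f) (x i))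
    have h4 : ‖((‖f‖ : ℝ) : 𝕜)‖ₑ = ‖f‖ₑ := by
      rw [← ofReal_norm, RCLike.norm_ofReal, abs_norm, ofReal_norm]
    rw [h4] at h3
    calc pnorm q (fun i => f (x i)) = _ := by
          congr 1; funext i; simp [mul_inv_cancel_left₀ h0]
      _ = _ := h3
      _ ≤ _ := by gcongr

lemma wnorm_smul_le [Fact (1 ≤ q)] (c : 𝕜) (x : ι → E) :
    wnorm 𝕜 q (fun i => c • x i) ≤ ‖c‖ₑ * wnorm 𝕜 q x := by
  refine wnorm_le_iff.2 fun f hf => ?_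
  simp only [map_smul]
  rw [pnorm_smul]
  gcongr
  exact wnorm_le_iff.1 le_rfl f hf

lemma wnorm_add_le [Fact (1 ≤ q)] (x y : ι → E) :
    wnorm 𝕜 q (fun i => x i + y i) ≤ wnorm 𝕜 q x + wnorm 𝕜 q y := by
  refine wnorm_le_iff.2 fun f hf => ?_
  simp only [map_add]
  exact (pnorm_add_le _ _).trans
    (add_le_add (wnorm_le_iff.1 le_rfl f hf) (wnorm_le_iff.1 le_rfl f hf))

lemma wnorm_comp_le [Fact (1 ≤ q)] {e : ι → κ} (he : Function.Injective e) (y : κ → E) :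
    wnorm 𝕜 q (fun i => y (e i)) ≤ wnorm 𝕜 q y :=
  wnorm_le_iff.2 fun f hf => (pnorm_le_pnorm_of_injective he fun _ => le_rfl).trans
    (wnorm_le_iff.1 le_rfl f hf)

/-- Replacing some members of a system by zero does not increase the weak norm. -/
lemma wnorm_mono_of_eq_or_zero [Fact (1 ≤ q)] {x y : ι → E} (h : ∀ i, x i = y i ∨ x i = 0) :
    wnorm 𝕜 q x ≤ wnorm 𝕜 q y := by
  refine wnorm_le_iff.2 fun f hf => (pnorm_mono fun i => ?_).trans (wnorm_le_iff.1 le_rfl f hf)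
  rcases h i with h | h <;> simp [h]

/-- A finitely supported system has finite weak norm. -/
lemma wnorm_lt_top_of_finite [Fact (1 ≤ p)] {x : ι → E} (s : Finset ι) (h : ∀ i ∉ s, x i = 0) :
    wnorm 𝕜 p.conjExponent x < ∞ := by
  classical
  refine lt_of_le_of_lt (b := ∑ i ∈ s, ‖x i‖ₑ) (wnorm_le_of_dual fun t a ha => ?_)
    (ENNReal.sum_lt_top.2 fun _ _ => enorm_lt_top)
  refine (enorm_sum_le _ _).trans ?_
  calc ∑ i ∈ t, ‖a i • x i‖ₑ ≤ ∑ i ∈ t, ‖x i‖ₑ := by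
        gcongr with i
        rw [enorm_smul]
        exact mul_le_of_le_one_left' ((enorm_le_pnorm a i).trans ha)
    _ = ∑ i ∈ t with i ∈ s, ‖x i‖ₑ := by
        rw [Finset.sum_filter]
        refine Finset.sum_congr rfl fun i _ => ?_
        split_ifs with hi
        · rfl
        · simp [h i hi]
    _ ≤ _ := Finset.sum_le_sum_of_subset fun i hi => (Finset.mem_filter.1 hi).2

/-- A sequence is weakly `p'`-summable exactly if its weak norm is finite: by the uniform
boundedness principle, applied to the functionals `f ↦ f (∑ aᵢ xᵢ)` on the dual, where `a` runs
through the finite sections of the unit ball of `ℓ_p`. -/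
lemma weaklySummable_iff [Fact (1 ≤ p)] {x : ℕ → E} :
    WeaklySummable 𝕜 p.conjExponent x ↔ wnorm 𝕜 p.conjExponent x < ∞ := by
  refine ⟨fun h => ?_, fun h f => (pnorm_apply_le f x).trans_lt (ENNReal.mul_lt_top enorm_lt_top h)⟩
  let T (k : Finset ℕ × {a : ℕ → 𝕜 // pnorm p a ≤ 1}) : StrongDual 𝕜 E →L[𝕜] 𝕜 :=
    NormedSpace.inclusionInDoubleDual 𝕜 E (∑ i ∈ k.1, k.2.1 i • x i)
  obtain ⟨C, hC⟩ := banach_steinhaus (g := T) fun f => by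
    refine ⟨(pnorm p.conjExponent fun i => f (x i)).toReal, fun k => ?_⟩
    have h1 : ‖T k f‖ₑ ≤ pnorm p.conjExponent fun i => f (x i) := by
      calc ‖T k f‖ₑ = ‖∑ i ∈ k.1, k.2.1 i * f (x i)‖ₑ := by simp [T]
        _ ≤ ∑ i ∈ k.1, ‖k.2.1 i‖ₑ * ‖f (x i)‖ₑ := by
          refine (enorm_sum_le _ _).trans (le_of_eq ?_)
          simp [enorm_mul]
        _ ≤ _ := sum_enorm_mul_le _ _ _
        _ ≤ _ := mul_le_of_le_one_left' k.2.2
    simpa using ENNReal.toReal_mono (h f).ne h1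
  refine lt_of_le_of_lt (wnorm_le_of_dual fun s a ha => ?_) (ENNReal.ofReal_lt_top (r := C))
  rw [← ofReal_norm, ← (NormedSpace.inclusionInDoubleDualLi 𝕜 (E := E)).norm_map]
  exact ENNReal.ofReal_le_ofReal (hC (s, ⟨a, ha⟩))

/-- To lie in `ℓ_{p'}^u(E)`, it is enough that removing suitable finite sets of members makes the
weak norm small. -/
lemma uncondSummable_of_finset [Fact (1 ≤ p)] {x : ℕ → E}
    (h : ∀ ε : ℝ≥0∞, 0 < ε → ∃ s : Finset ℕ,
      wnorm 𝕜 p.conjExponent (fun i => if i ∈ s then 0 else x i) ≤ ε) :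
    UncondSummable 𝕜 p.conjExponent x := by
  constructor
  · obtain ⟨s, hs⟩ := h 1 one_pos
    rw [weaklySummable_iff]
    have h1 : wnorm 𝕜 p.conjExponent (fun i => if i ∈ s then x i else 0) < ∞ :=
      wnorm_lt_top_of_finite s fun i hi => by simp [hi]
    refine lt_of_le_of_lt ?_ (ENNReal.add_lt_top.2 ⟨h1, hs.trans_lt ENNReal.one_lt_top⟩)
    refine le_trans (le_of_eq ?_) (wnorm_add_le _ _)
    congr 1
    funext i
    split_ifs <;> simp
  · rw [ENNReal.tendsto_atTop_zero]
    intro ε hε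
    obtain ⟨s, hs⟩ := h ε hε
    obtain ⟨N, hN⟩ := s.exists_nat_subset_range
    refine ⟨N, fun M hM => le_trans (wnorm_mono_of_eq_or_zero fun i => ?_) hs⟩
    by_cases hi : i < M
    · simp [hi]
    · have : i ∉ s := fun h => hi ((Finset.mem_range.1 (hN h)).trans_le hM)
      simp [hi, this]

end wnorm

/-! ### The conditions on sequences -/

section gluing

variable {𝕜 ι κ E : Type*} [RCLike 𝕜] [NormedAddCommGroup E] [NormedSpace 𝕜 E] {p q : ℝ≥0∞}

lemma wnorm_zero [Fact (1 ≤ q)] : wnorm 𝕜 q (fun _ : ι => (0 : E)) = 0 := by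
  simpa using wnorm_smul_le (q := q) (0 : 𝕜) (fun _ : ι => (0 : E))

/-- Members that vanish do not contribute to the weak norm. -/
lemma wnorm_le_wnorm_comp [Fact (1 ≤ q)] {e : ι → κ} (he : Function.Injective e) {y : κ → E}
    (hy : ∀ k ∉ Set.range e, y k = 0) : wnorm 𝕜 q y ≤ wnorm 𝕜 q (fun i => y (e i)) :=
  wnorm_le_iff.2 fun f hf => (pnorm_le_pnorm_comp he fun k hk => by simp [hy k hk]).trans
    (wnorm_le_iff.1 le_rfl f hf)

/-- The weak norm is subadditive along a partition of the index set. -/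
lemma wnorm_le_tsum_fiber [DecidableEq κ] [Fact (1 ≤ p)] (idx : ι → κ) (y : ι → E) :
    wnorm 𝕜 p.conjExponent y
      ≤ ∑' k, wnorm 𝕜 p.conjExponent (fun i => if idx i = k then y i else 0) := by
  refine wnorm_le_of_dual fun s a ha => ?_
  rw [← Finset.sum_fiberwise_of_maps_to (t := s.image idx) (g := idx)
    (fun i hi => Finset.mem_image_of_mem _ hi)]
  refine (enorm_sum_le _ _).trans (le_trans ?_ (ENNReal.sum_le_tsum (s.image idx)))
  gcongr with k
  calc ‖∑ i ∈ s with idx i = k, a i • y i‖ₑ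
      = ‖∑ i ∈ s, a i • (if idx i = k then y i else 0)‖ₑ := by
        rw [Finset.sum_filter]
        congr 1
        refine Finset.sum_congr rfl fun i _ => ?_
        split_ifs <;> simp
    _ ≤ _ := enorm_sum_smul_le s a _
    _ ≤ _ := mul_le_of_le_one_left' ha

end gluing

section conditions

variable {𝕜 : Type*} [RCLike 𝕜] {Ω X Y : Type*} [TopologicalSpace Ω] [CompactSpace Ω]
    [NormedAddCommGroup X] [NormedSpace 𝕜 X] [NormedAddCommGroup Y] [NormedSpace 𝕜 Y]
    {p : ℝ≥0∞} [Fact (1 ≤ p)] {S : C(Ω, 𝕜) →L[𝕜] X →L[𝕜] Y}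

/-- By homogeneity, the inequality for finite systems need only be checked on normalized ones. -/
lemma finiteIneq_of_normalized (c : ℝ≥0)
    (h : ∀ (n : ℕ) (x : Fin n → X) (φ : Fin n → C(Ω, 𝕜)), (∀ i, ‖x i‖ₑ ≤ 1) →
      wnorm 𝕜 p.conjExponent φ ≤ 1 → wnorm 𝕜 p.conjExponent (fun i => S (φ i) (x i)) ≤ c) :
    FiniteIneq p.conjExponent S := by
  refine ⟨c + 1, by positivity, fun n x φ => ?_⟩
  set A := pnorm ∞ x with hA
  set B := wnorm 𝕜 p.conjExponent φ with hB
  have hAx (i) : ‖x i‖ₑ ≤ A := pnorm_top_le_iff.1 le_rfl i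
  have hBφ (i) : ‖φ i‖ₑ ≤ B := enorm_le_wnorm φ i
  have hA1 : A ≠ ∞ :=
    ((pnorm_lt_top_iff x).2 (memℓp_infty (Set.finite_range _).bddAbove)).ne
  have hB1 : B ≠ ∞ := (wnorm_lt_top_of_finite Finset.univ fun i hi => by simp at hi).ne
  by_cases hA0 : A = 0
  · have : ∀ i, x i = 0 := fun i => by simpa [hA0] using hAx i
    simp [this, wnorm_zero]
  by_cases hB0 : B = 0
  · have : ∀ i, φ i = 0 := fun i => by simpa [hB0] using hBφ i
    simp [this, wnorm_zero]
  have hα : 0 < A.toReal := ENNReal.toReal_pos hA0 hA1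
  have hβ : 0 < B.toReal := ENNReal.toReal_pos hB0 hB1
  set α : 𝕜 := ((A.toReal : ℝ) : 𝕜) with hαdef
  set β : 𝕜 := ((B.toReal : ℝ) : 𝕜) with hβdef
  have hα0 : α ≠ 0 := by simpa [hαdef] using hα.ne'
  have hβ0 : β ≠ 0 := by simpa [hβdef] using hβ.ne'
  have hαn : ‖α‖ₑ = A := by
    rw [← ofReal_norm, RCLike.norm_ofReal, abs_of_pos hα, ENNReal.ofReal_toReal hA1]
  have hβn : ‖β‖ₑ = B := by
    rw [← ofReal_norm, RCLike.norm_ofReal, abs_of_pos hβ, ENNReal.ofReal_toReal hB1]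
  have key := h n (fun i => α⁻¹ • x i) (fun i => β⁻¹ • φ i) (fun i => by
      rw [enorm_smul, enorm_inv hα0, hαn]
      exact (mul_le_mul_right (hAx i) _).trans (ENNReal.inv_mul_cancel hA0 hA1).le)
    (by
      refine (wnorm_smul_le _ _).trans ?_
      rw [enorm_inv hβ0, hβn, ENNReal.inv_mul_cancel hB0 hB1])
  calc wnorm 𝕜 p.conjExponent (fun i => S (φ i) (x i))
      = wnorm 𝕜 p.conjExponent (fun i => (α * β) • S (β⁻¹ • φ i) (α⁻¹ • x i)) := by
        congr 1
        funext i
        simp only [map_smul, smul_apply, smul_smul]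
        rw [show α * β * (α⁻¹ * β⁻¹) = 1 by field_simp, one_smul]
    _ ≤ _ := wnorm_smul_le _ _
    _ ≤ ‖α * β‖ₑ * (c + 1) := by gcongr; exact key.trans le_self_add
    _ = _ := by rw [enorm_mul, hαn, hβn]; push_cast; ring

/-- The inequality for finite systems carries over to systems with arbitrary index sets, because
weak norms are determined by finite subsystems. -/
lemma wnorm_apply_le_of_finite {c : ℝ≥0}
    (h : ∀ (n : ℕ) (x : Fin n → X) (φ : Fin n → C(Ω, 𝕜)),
      wnorm 𝕜 p.conjExponent (fun i => S (φ i) (x i))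
        ≤ c * pnorm ∞ x * wnorm 𝕜 p.conjExponent φ)
    {ι : Type*} (x : ι → X) (φ : ι → C(Ω, 𝕜)) :
    wnorm 𝕜 p.conjExponent (fun i => S (φ i) (x i))
      ≤ c * pnorm ∞ x * wnorm 𝕜 p.conjExponent φ := by
  refine wnorm_le_of_dual fun s a ha => ?_
  let e : Fin s.card → ι := fun j => s.equivFin.symm j
  have he : Function.Injective e := Subtype.val_injective.comp s.equivFin.symm.injective
  have hsum : ∑ i ∈ s, a i • S (φ i) (x i) = ∑ j, a (e j) • S (φ (e j)) (x (e j)) := by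
    rw [← Finset.sum_coe_sort s,
      ← s.equivFin.symm.sum_comp (fun i : s => a i • S (φ i) (x i))]
  rw [hsum]
  calc _ ≤ pnorm p (fun j => a (e j))
          * wnorm 𝕜 p.conjExponent (fun j => S (φ (e j)) (x (e j))) := enorm_sum_smul_le _ _ _
    _ ≤ 1 * (c * pnorm ∞ (fun j => x (e j)) * wnorm 𝕜 p.conjExponent (fun j => φ (e j))) := by
        gcongr
        · exact (pnorm_le_pnorm_of_injective he fun _ => le_rfl).trans ha
        · exact h _ _ _
    _ ≤ _ := by
        rw [one_mul]
        gcongr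
        · exact pnorm_top_le_iff.2 fun j => pnorm_top_le_iff.1 le_rfl (e j)
        · exact wnorm_comp_le he φ

lemma FiniteIneq.tailIneq (h : FiniteIneq p.conjExponent S) : TailIneq p.conjExponent S := by
  obtain ⟨c, hc, h⟩ := h
  exact ⟨c, hc, fun x φ _ _ n => wnorm_apply_le_of_finite h _ _⟩

lemma TailIneq.mapsBddWeak (h : TailIneq p.conjExponent S) : MapsBddWeak p.conjExponent S := by
  obtain ⟨c, -, h⟩ := h
  intro x φ hx hφ
  have h0 := h x φ hx hφ 0
  simp only [zero_add] at h0
  rw [weaklySummable_iff] at hφ ⊢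
  exact h0.trans_lt (ENNReal.mul_lt_top (ENNReal.mul_lt_top ENNReal.coe_lt_top hx) hφ)

lemma pnorm_top_lt_top_of_tendsto {x : ℕ → X} {a : X} (h : Tendsto x atTop (𝓝 a)) :
    pnorm ∞ x < ∞ := by
  obtain ⟨C, hC⟩ := h.norm.bddAbove_range
  exact (pnorm_lt_top_iff x).2 (memℓp_infty ⟨C, hC⟩)

/-- The tails of `((S φᵢ) xᵢ)` are estimated by those of `(xᵢ)` and `(φᵢ)`. -/
lemma wnorm_sub_truncation_le {c : ℝ≥0}
    (h : ∀ (n : ℕ) (x : Fin n → X) (φ : Fin n → C(Ω, 𝕜)),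
      wnorm 𝕜 p.conjExponent (fun i => S (φ i) (x i))
        ≤ c * pnorm ∞ x * wnorm 𝕜 p.conjExponent φ)
    (x : ℕ → X) (φ : ℕ → C(Ω, 𝕜)) (N : ℕ) :
    wnorm 𝕜 p.conjExponent (fun i => S (φ i) (x i) - if i < N then S (φ i) (x i) else 0)
      ≤ c * pnorm ∞ (fun i => if i < N then 0 else x i)
        * wnorm 𝕜 p.conjExponent (fun i => φ i - if i < N then φ i else 0) := by
  refine le_trans (le_of_eq ?_) (wnorm_apply_le_of_finite h _ _)
  congr 1
  funext i
  split_ifs <;> simp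

lemma FiniteIneq.mapsC0Weak (h : FiniteIneq p.conjExponent S) : MapsC0Weak p.conjExponent S := by
  intro x φ hx hφ
  have hx' := pnorm_top_lt_top_of_tendsto hx
  refine ⟨h.tailIneq.mapsBddWeak x φ hx' hφ, ?_⟩
  obtain ⟨c, -, h⟩ := h
  rw [weaklySummable_iff] at hφ
  have hlim := (MemLpC0.tendsto_tail (p := ∞) ⟨hx', fun _ => hx⟩)
  have hlim' := ENNReal.Tendsto.mul_const (b := wnorm 𝕜 p.conjExponent φ)
    (ENNReal.Tendsto.const_mul hlim (Or.inr ENNReal.coe_ne_top) (a := c)) (Or.inr hφ.ne)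
  rw [mul_zero, zero_mul] at hlim'
  refine tendsto_of_tendsto_of_tendsto_of_le_of_le tendsto_const_nhds hlim' (fun _ => zero_le)
    fun N => (wnorm_sub_truncation_le h x φ N).trans ?_
  gcongr
  exact wnorm_mono_of_eq_or_zero fun i => by by_cases hi : i < N <;> simp [hi]

lemma FiniteIneq.mapsBddUncond (h : FiniteIneq p.conjExponent S) :
    MapsBddUncond p.conjExponent S := by
  intro x φ hx hφ
  refine ⟨h.tailIneq.mapsBddWeak x φ hx hφ.1, ?_⟩
  obtain ⟨c, -, h⟩ := h
  have hlim' := ENNReal.Tendsto.const_mul (a := c * pnorm ∞ x) hφ.2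
    (Or.inr (ENNReal.mul_lt_top ENNReal.coe_lt_top hx).ne)
  rw [mul_zero] at hlim'
  refine tendsto_of_tendsto_of_tendsto_of_le_of_le tendsto_const_nhds hlim' (fun _ => zero_le)
    fun N => (wnorm_sub_truncation_le h x φ N).trans ?_
  gcongr
  refine pnorm_mono fun i => ?_
  split_ifs <;> simp

/-- The gliding hump behind the necessity of the inequality: finite systems violating it with
constants that grow fast enough are scaled down and strung together, giving a null sequence
`(xᵢ)` and an unconditionally `p'`-summable sequence `(φᵢ)` for which `((S φᵢ) xᵢ)` is not weakly
`p'`-summable. -/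
lemma finiteIneq_of_forall_weaklySummable
    (h : ∀ (x : ℕ → X) (φ : ℕ → C(Ω, 𝕜)), Tendsto x atTop (𝓝 0) →
      UncondSummable 𝕜 p.conjExponent φ →
      WeaklySummable 𝕜 p.conjExponent (fun i => S (φ i) (x i))) :
    FiniteIneq p.conjExponent S := by
  by_contra hcon
  have hbad (k : ℕ) : ∃ (n : ℕ) (x : Fin n → X) (φ : Fin n → C(Ω, 𝕜)), (∀ i, ‖x i‖ₑ ≤ 1) ∧
      wnorm 𝕜 p.conjExponent φ ≤ 1 ∧ ‖(4 : 𝕜) ^ k * 4 ^ k‖ₑ * k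
        < wnorm 𝕜 p.conjExponent (fun i => S (φ i) (x i)) := by
    by_contra hk
    push Not at hk
    refine hcon (finiteIneq_of_normalized (‖(4 : 𝕜) ^ k * 4 ^ k‖₊ * k) fun n x φ hx hφ => ?_)
    push_cast
    exact hk n x φ hx hφ
  choose n x φ hx hφ hlt using hbad
  -- The `i`-th member of the `k`-th system is placed at `Nat.pair k i`.
  let x' : ℕ → X := fun m => if hm : m.unpair.2 < n m.unpair.1 then
    ((4 : 𝕜) ^ m.unpair.1)⁻¹ • x m.unpair.1 ⟨m.unpair.2, hm⟩ else 0
  let φ' : ℕ → C(Ω, 𝕜) := fun m => if hm : m.unpair.2 < n m.unpair.1 then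
    ((4 : 𝕜) ^ m.unpair.1)⁻¹ • φ m.unpair.1 ⟨m.unpair.2, hm⟩ else 0
  have hx'eq (k : ℕ) (i : Fin (n k)) : x' (Nat.pair k i) = ((4 : 𝕜) ^ k)⁻¹ • x k i := by
    have hm : (Nat.pair k i).unpair.2 < n (Nat.pair k i).unpair.1 := by simp
    simp only [x', dif_pos hm]
    congr 2
    · simp
    · simp
    · exact (Fin.heq_ext_iff (by simp)).2 (by simp)
  have hφ'eq (k : ℕ) (i : Fin (n k)) : φ' (Nat.pair k i) = ((4 : 𝕜) ^ k)⁻¹ • φ k i := by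
    have hm : (Nat.pair k i).unpair.2 < n (Nat.pair k i).unpair.1 := by simp
    simp only [φ', dif_pos hm]
    congr 2
    · simp
    · simp
    · exact (Fin.heq_ext_iff (by simp)).2 (by simp)
  have hinj (k : ℕ) : Function.Injective (fun i : Fin (n k) => Nat.pair k i) := fun i j hij =>
    Fin.ext (Nat.pair_eq_pair.1 hij).2
  have h4 (k : ℕ) : ‖((4 : 𝕜) ^ k)⁻¹‖ₑ = 2⁻¹ ^ k * 2⁻¹ ^ k := by
    rw [enorm_inv (by simp), enorm_pow, ← mul_pow, ← ENNReal.mul_inv (by simp) (by simp),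
      ENNReal.inv_pow, ← ofReal_norm, RCLike.norm_ofNat]
    norm_num
  have hhalf : Tendsto (fun K : ℕ => (2⁻¹ : ℝ≥0∞) ^ K * 2) atTop (𝓝 0) := by
    have := ENNReal.Tendsto.mul_const (b := 2)
      (ENNReal.tendsto_pow_atTop_nhds_zero_of_lt_one (r := 2⁻¹) (by simp)) (Or.inr (by simp))
    rwa [zero_mul] at this
  -- The positions occupied by the first `K` systems.
  let s : ℕ → Finset ℕ := fun K =>
    ((Finset.range K).sigma fun k => Finset.range (n k)).image fun z => Nat.pair z.1 z.2
  have hs (K m : ℕ) (hm : m ∉ s K) (hlt : m.unpair.2 < n m.unpair.1) : K ≤ m.unpair.1 := by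
    by_contra hK
    refine hm (Finset.mem_image.2 ⟨⟨m.unpair.1, m.unpair.2⟩, ?_, Nat.pair_unpair m⟩)
    simp only [Finset.mem_sigma, Finset.mem_range]
    exact ⟨not_le.1 hK, hlt⟩
  have hx'0 : Tendsto x' atTop (𝓝 0) := by
    rw [tendsto_zero_iff_enorm_tendsto_zero, ENNReal.tendsto_atTop_zero]
    intro ε hε
    obtain ⟨K, hK⟩ := (ENNReal.tendsto_atTop_zero.1 hhalf) ε hε
    obtain ⟨N, hN⟩ := (s K).exists_nat_subset_range
    refine ⟨N, fun m hm => ?_⟩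
    have hms : m ∉ s K := fun h => by
      have := Finset.mem_range.1 (hN h)
      omega
    by_cases hlt : m.unpair.2 < n m.unpair.1
    · refine le_trans ?_ (hK _ (hs K m hms hlt))
      simp only [x', dif_pos hlt]
      rw [enorm_smul, h4, mul_assoc]
      gcongr
      refine (mul_le_mul' (pow_le_one' (by simp) _) (hx _ _)).trans ?_
      norm_num
    · simp [x', dif_neg hlt]
  have hφ'0 : UncondSummable 𝕜 p.conjExponent φ' := by
    refine uncondSummable_of_finset fun ε hε => ?_
    obtain ⟨K, hK⟩ := (ENNReal.tendsto_atTop_zero.1 hhalf) ε hε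
    refine ⟨s K, le_trans ?_ (hK K le_rfl)⟩
    refine (wnorm_le_tsum_fiber (fun m => m.unpair.1) _).trans ?_
    rw [show (2⁻¹ : ℝ≥0∞) ^ K * 2 = ∑' k : ℕ, 2⁻¹ ^ K * 2⁻¹ ^ k by
      rw [ENNReal.tsum_mul_left, ENNReal.tsum_geometric_two]]
    refine ENNReal.tsum_le_tsum fun k => ?_
    by_cases hk : K ≤ k
    · calc wnorm 𝕜 p.conjExponent
            (fun m => if m.unpair.1 = k then if m ∈ s K then 0 else φ' m else 0)
          ≤ wnorm 𝕜 p.conjExponent (fun m => if m.unpair.1 = k then φ' m else 0) :=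
            wnorm_mono_of_eq_or_zero fun m => by split_ifs <;> simp
        _ ≤ wnorm 𝕜 p.conjExponent (fun i : Fin (n k) =>
              if (Nat.pair k i).unpair.1 = k then φ' (Nat.pair k i) else 0) := by
            refine wnorm_le_wnorm_comp (hinj k) fun m hm => ?_
            split_ifs with hmk
            · refine dif_neg fun hlt => hm ⟨⟨m.unpair.2, hmk ▸ hlt⟩, ?_⟩
              subst hmk
              exact Nat.pair_unpair m
            · rfl
        _ = wnorm 𝕜 p.conjExponent (fun i => ((4 : 𝕜) ^ k)⁻¹ • φ k i) := by
            simp [hφ'eq]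
        _ ≤ _ := wnorm_smul_le _ _
        _ ≤ 2⁻¹ ^ k * 2⁻¹ ^ k := by
            rw [h4]
            exact mul_le_of_le_one_right' (hφ k)
        _ ≤ 2⁻¹ ^ K * 2⁻¹ ^ k :=
            mul_le_mul' (pow_le_pow_right_of_le_one' (by simp) hk) le_rfl
    · refine le_trans (le_of_eq ?_) zero_le
      rw [← wnorm_zero (𝕜 := 𝕜) (ι := ℕ) (E := C(Ω, 𝕜)) (q := p.conjExponent)]
      congr 1
      funext m
      split_ifs with h1 h2
      · rfl
      · exact dif_neg fun hlt => hk (h1 ▸ hs K m h2 hlt)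
      · rfl
  have hfin := weaklySummable_iff.1 (h x' φ' hx'0 hφ'0)
  set W := wnorm 𝕜 p.conjExponent (fun i => S (φ' i) (x' i))
  obtain ⟨k, hk⟩ := ENNReal.exists_nat_gt hfin.ne
  refine absurd (hlt k) (not_lt.2 ?_)
  calc wnorm 𝕜 p.conjExponent (fun i => S (φ k i) (x k i))
      = wnorm 𝕜 p.conjExponent (fun i : Fin (n k) =>
          ((4 : 𝕜) ^ k * 4 ^ k) • S (φ' (Nat.pair k i)) (x' (Nat.pair k i))) := by
        congr 1
        funext i
        rw [hx'eq, hφ'eq]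
        simp only [map_smul, smul_apply, smul_smul]
        rw [show (4 : 𝕜) ^ k * 4 ^ k * ((4 ^ k)⁻¹ * (4 ^ k)⁻¹) = 1 by field_simp, one_smul]
    _ ≤ _ := wnorm_smul_le _ _
    _ ≤ ‖(4 : 𝕜) ^ k * 4 ^ k‖ₑ * W := by
        gcongr
        exact wnorm_comp_le (hinj k) (fun m => S (φ' m) (x' m))
    _ ≤ _ := by gcongr

/-- The conditions on sequences are equivalent to the inequality for finite systems. -/
lemma tfae_sequence_conditions (p : ℝ≥0∞) [Fact (1 ≤ p)] (S : C(Ω, 𝕜) →L[𝕜] X →L[𝕜] Y) :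
    List.TFAE [FiniteIneq p.conjExponent S, TailIneq p.conjExponent S,
      MapsBddWeak p.conjExponent S, MapsC0Weak p.conjExponent S,
      MapsBddUncond p.conjExponent S] := by
  tfae_have 1 → 2 := FiniteIneq.tailIneq
  tfae_have 2 → 3 := TailIneq.mapsBddWeak
  tfae_have 1 → 4 := FiniteIneq.mapsC0Weak
  tfae_have 1 → 5 := FiniteIneq.mapsBddUncond
  tfae_have 3 → 1 := fun h => finiteIneq_of_forall_weaklySummable fun x φ hx hφ =>
    h x φ (pnorm_top_lt_top_of_tendsto hx) hφ.1
  tfae_have 4 → 1 := fun h => finiteIneq_of_forall_weaklySummable fun x φ hx hφ =>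
    (h x φ hx hφ.1).1
  tfae_have 5 → 1 := fun h => finiteIneq_of_forall_weaklySummable fun x φ hx hφ =>
    (h x φ (pnorm_top_lt_top_of_tendsto hx) hφ).1
  tfae_finish

end conditions

/-! ### Hulls and compactness -/

section hullCompact

variable {𝕜 κ E : Type*} [RCLike 𝕜] [NormedAddCommGroup E] [NormedSpace 𝕜 E]
    {p q : ℝ≥0∞}

/-- A system of nonnegative reals with sum one has total size one in `𝕜`. -/
lemma sum_enorm_ofReal {s : Finset κ} {c : κ → ℝ} (hc : ∀ k, 0 ≤ c k) (h1 : ∑ k ∈ s, c k = 1) :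
    ∑ k ∈ s, ‖((c k : ℝ) : 𝕜)‖ₑ = 1 := by
  have (k : κ) : ‖((c k : ℝ) : 𝕜)‖ₑ = ENNReal.ofReal (c k) := by
    rw [← ofReal_norm, RCLike.norm_ofReal, abs_of_nonneg (hc k)]
  simp only [this]
  rw [← ENNReal.ofReal_sum_of_nonneg fun k _ => hc k, h1, ENNReal.ofReal_one]

lemma pnorm_convex_combination_le {ι : Type*} [Fact (1 ≤ p)] {s : Finset κ} {c : κ → ℝ}
    (hc : ∀ k, 0 ≤ c k) (h1 : ∑ k ∈ s, c k = 1) {α : κ → ι → E} {C : ℝ≥0∞}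
    (hα : ∀ k, c k ≠ 0 → pnorm p (α k) ≤ C) :
    pnorm p (fun i => ∑ k ∈ s, ((c k : ℝ) : 𝕜) • α k i) ≤ C := by
  refine (pnorm_finset_sum_le s _).trans ?_
  calc ∑ k ∈ s, pnorm p (fun i => ((c k : ℝ) : 𝕜) • α k i)
      ≤ ∑ k ∈ s, ‖((c k : ℝ) : 𝕜)‖ₑ * C := by
        refine Finset.sum_le_sum fun k _ => ?_
        rw [pnorm_smul]
        by_cases h0 : c k = 0
        · simp [h0]
        · gcongr
          exact hα k h0
    _ = C := by rw [← Finset.sum_mul, sum_enorm_ofReal hc h1, one_mul]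

lemma norm_convex_combination_le {s : Finset κ} {c : κ → ℝ} (hc : ∀ k, 0 ≤ c k)
    (h1 : ∑ k ∈ s, c k = 1) {v : κ → E} {C : ℝ} (hv : ∀ k, c k ≠ 0 → ‖v k‖ ≤ C) :
    ‖∑ k ∈ s, ((c k : ℝ) : 𝕜) • v k‖ ≤ C := by
  refine (norm_sum_le _ _).trans ?_
  calc ∑ k ∈ s, ‖((c k : ℝ) : 𝕜) • v k‖ ≤ ∑ k ∈ s, c k * C := by
        refine Finset.sum_le_sum fun k _ => ?_
        rw [norm_smul, RCLike.norm_ofReal, abs_of_nonneg (hc k)]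
        by_cases h0 : c k = 0
        · simp [h0]
        · exact mul_le_mul_of_nonneg_left (hv k h0) (hc k)
    _ = C := by rw [← Finset.sum_mul, h1, one_mul]

lemma convex_combination_mem_hull [Fact (1 ≤ p)] {z : ℕ → E} {s : Finset κ} {c : κ → ℝ}
    (hc : ∀ k, 0 ≤ c k) (h1 : ∑ k ∈ s, c k = 1) {v : κ → E}
    (hv : ∀ k, c k ≠ 0 → v k ∈ hull 𝕜 p z) :
    ∑ k ∈ s, ((c k : ℝ) : 𝕜) • v k ∈ hull 𝕜 p z := by
  have hv' (k : κ) : ∃ α : ℕ → 𝕜, (c k ≠ 0 → pnorm p.conjExponent α ≤ 1) ∧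
      HasSum (fun n => (((c k : ℝ) : 𝕜) • α n) • z n) (((c k : ℝ) : 𝕜) • v k) := by
    by_cases h0 : c k = 0
    · exact ⟨0, fun h => absurd h0 h, by simp [h0, hasSum_zero]⟩
    · obtain ⟨α, hα, hs⟩ := hv k h0
      exact ⟨α, fun _ => hα, by simpa [smul_smul] using hs.const_smul ((c k : ℝ) : 𝕜)⟩
  choose α hα hs using hv'
  refine ⟨fun n => ∑ k ∈ s, ((c k : ℝ) : 𝕜) • α k n, pnorm_convex_combination_le hc h1 hα, ?_⟩
  simp only [Finset.sum_smul]
  exact hasSum_sum fun k _ => hs k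

lemma isClosed_pnorm_le [Fact (1 ≤ p)] (C : ℝ≥0∞) :
    IsClosed {β : ℕ → 𝕜 | pnorm p.conjExponent β ≤ C} := by
  have : {β : ℕ → 𝕜 | pnorm p.conjExponent β ≤ C} =
      ⋂ (s : Finset ℕ) (a : {a : ℕ → 𝕜 // pnorm p a ≤ 1}),
        {β | ‖∑ i ∈ s, a.1 i * β i‖ₑ ≤ C} := by
    ext β
    simp only [Set.mem_ofPred_eq, Set.mem_iInter]
    refine ⟨fun h s a => ?_, fun h => pnorm_le_of_dual fun s a ha => h s ⟨a, ha⟩⟩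
    refine (enorm_sum_le _ _).trans ?_
    simp only [enorm_mul]
    exact (sum_enorm_mul_le s a.1 β).trans ((mul_le_of_le_one_left' a.2).trans h)
  rw [this]
  exact isClosed_iInter fun s => isClosed_iInter fun a =>
    isClosed_le (by fun_prop) continuous_const

/-- Balls of `ℓ_{p'}` are compact for coordinatewise convergence. -/
lemma isCompact_pnorm_le [Fact (1 ≤ p)] (C : ℝ≥0) :
    IsCompact {β : ℕ → 𝕜 | pnorm p.conjExponent β ≤ C} := by
  refine (isCompact_univ_pi fun _ : ℕ => isCompact_closedBall (0 : 𝕜) C).of_isClosed_subset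
    (isClosed_pnorm_le _) fun β hβ => ?_
  refine Set.mem_univ_pi.2 fun n => mem_closedBall_zero_iff.2 ?_
  have := (enorm_le_pnorm β n).trans hβ
  rwa [enorm_eq_nnnorm, ENNReal.coe_le_coe] at this

lemma summable_smul_of_pnorm_lt_top [CompleteSpace E] [Fact (1 ≤ p)] {β : ℕ → 𝕜} {x : ℕ → E}
    (hβ : pnorm p.conjExponent β < ∞) (hx : pnorm p x < ∞) : Summable fun n => β n • x n := by
  refine Summable.of_norm ?_
  have h : ∑' n, ‖β n • x n‖ₑ ≠ ∞ := by
    simp only [enorm_smul]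
    exact ((tsum_mul_le β x).trans_lt (ENNReal.mul_lt_top hβ hx)).ne
  simp only [enorm_eq_nnnorm] at h
  exact NNReal.summable_coe.2 (ENNReal.tsum_coe_ne_top_iff_summable.1 h)

/-- On balls of `ℓ_{p'}`, the map `β ↦ ∑ βₙ xₙ` is continuous for coordinatewise convergence. -/
lemma continuousOn_tsum_smul [CompleteSpace E] [Fact (1 ≤ p)] {x : ℕ → E} (hx : MemLpC0 p x)
    (C : ℝ≥0) : ContinuousOn (fun β : ℕ → 𝕜 => ∑' n, β n • x n)
      {β : ℕ → 𝕜 | pnorm p.conjExponent β ≤ C} := by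
  refine continuousOn_of_uniform_approx_of_continuousOn fun U hU => ?_
  obtain ⟨ε, hε, hεU⟩ := mem_uniformity_edist.1 hU
  have hlim := ENNReal.Tendsto.const_mul (a := (C : ℝ≥0∞)) hx.tendsto_tail
    (Or.inr ENNReal.coe_ne_top)
  rw [mul_zero] at hlim
  obtain ⟨M, hM⟩ := (hlim.eventually_lt_const hε).exists
  refine ⟨fun β => ∑ n ∈ Finset.range M, β n • x n, by fun_prop, fun β hβ => hεU ?_⟩
  refine lt_of_le_of_lt ?_ hM
  have hs := summable_smul_of_pnorm_lt_top (lt_of_le_of_lt hβ ENNReal.coe_lt_top) hx.1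
  have h1 : HasSum (fun n => β n • if n < M then 0 else x n)
      (∑' n, β n • x n - ∑ n ∈ Finset.range M, β n • x n) := by
    have h2 : HasSum (fun n => if n ∈ Finset.range M then β n • x n else 0)
        (∑ n ∈ Finset.range M, β n • x n) := by
      have : HasSum (fun n => if n ∈ Finset.range M then β n • x n else 0)
          (∑ n ∈ Finset.range M, if n ∈ Finset.range M then β n • x n else 0) :=
        hasSum_sum_of_ne_finset_zero fun n hn => if_neg hn
      rwa [Finset.sum_congr rfl fun n hn => if_pos hn] at this
    convert hs.hasSum.sub h2 using 2 with n
    by_cases hn : n < M <;> simp [hn]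
  rw [edist_eq_enorm_sub]
  refine le_of_tendsto h1.enorm (Eventually.of_forall fun s => ?_)
  refine (enorm_sum_le _ _).trans ?_
  simp only [enorm_smul]
  exact (ENNReal.sum_le_tsum s).trans ((tsum_mul_le β _).trans (by gcongr; exact hβ))

/-- On `hull 𝕜 p x`, the norm topology controls the gauge of small `p`-compact hulls: differences
of small norm lie in the hull of a single sequence of small norm. This is the compactness argument
which makes a `p`-continuous function continuous into a space of coefficients. -/
lemma exists_sub_mem_hull_of_dist_lt [CompleteSpace E] [Fact (1 ≤ p)] {x : ℕ → E}
    (hx : MemLpC0 p x) {ε : ℝ≥0∞} (hε : 0 < ε) :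
    ∃ z : ℕ → E, MemLpC0 p z ∧ pnorm p z ≤ ε ∧ ∃ δ : ℝ, 0 < δ ∧
      ∀ u ∈ hull 𝕜 p x, ∀ v ∈ hull 𝕜 p x, dist u v < δ → u - v ∈ hull 𝕜 p z := by
  have hε2 : 0 < ε / 2 := ENNReal.half_pos hε.ne'
  -- The coefficients of the relevant differences will be small for `n < N` and bounded by `4` in
  -- norm for `n ≥ N`; hence the head of `x` is scaled by a small `η` and its tail by `8`.
  obtain ⟨N, hN⟩ : ∃ N, 8 * pnorm p (fun n => if n < N then 0 else x n) < ε / 2 := by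
    have hlim := ENNReal.Tendsto.const_mul (a := 8) hx.tendsto_tail (Or.inr (by simp))
    rw [mul_zero] at hlim
    exact (hlim.eventually_lt_const hε2).exists
  obtain ⟨η, hη, hηx⟩ := ENNReal.exists_nnreal_pos_mul_lt hx.1.ne hε2.ne'
  let w : ℕ → 𝕜 := fun n => if n < N then ((η : ℝ) : 𝕜) else 8
  have hηe : ‖((η : ℝ) : 𝕜)‖ₑ = η := by
    rw [← ofReal_norm, RCLike.norm_ofReal, NNReal.abs_eq, ENNReal.ofReal_coe_nnreal]
  have h8e : ‖(8 : 𝕜)‖ₑ = 8 := by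
    rw [← ofReal_norm, RCLike.norm_ofNat]; norm_num
  have hη0 : ((η : ℝ) : 𝕜) ≠ 0 := by simpa using hη.ne'
  have hw0 (n : ℕ) : w n ≠ 0 := by
    simp only [w]
    split_ifs
    · exact hη0
    · norm_num
  have hz : pnorm p (fun n => w n • x n) ≤ ε := by
    calc pnorm p (fun n => w n • x n)
        = pnorm p (fun n => (if n < N then ((η : ℝ) : 𝕜) • x n else 0)
            + (8 : 𝕜) • (if n < N then 0 else x n)) := by
          congr 1
          funext n
          simp only [w]
          split_ifs <;> simp
      _ ≤ pnorm p (fun n => if n < N then ((η : ℝ) : 𝕜) • x n else 0)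
            + pnorm p (fun n => (8 : 𝕜) • (if n < N then 0 else x n)) := pnorm_add_le _ _
      _ ≤ pnorm p (fun n => ((η : ℝ) : 𝕜) • x n)
            + pnorm p (fun n => (8 : 𝕜) • (if n < N then 0 else x n)) := by
          gcongr
          refine pnorm_mono fun n => ?_
          split_ifs <;> simp
      _ ≤ ε / 2 + ε / 2 := by
          rw [pnorm_smul, pnorm_smul, hηe, h8e]
          gcongr
      _ = ε := ENNReal.add_halves ε
  have hfin : pnorm p (fun n => w n • x n) < ∞ := by
    refine lt_of_le_of_lt (b := pnorm p (fun n => ((max (η : ℝ) 8 : ℝ) : 𝕜) • x n))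
      (pnorm_mono fun n => ?_) (by
        rw [pnorm_smul]; exact ENNReal.mul_lt_top enorm_lt_top hx.1)
    rw [enorm_smul, enorm_smul]
    gcongr
    rw [← ofReal_norm, ← ofReal_norm, RCLike.norm_ofReal, abs_of_nonneg (by positivity)]
    refine ENNReal.ofReal_le_ofReal ?_
    simp only [w]
    split_ifs
    · simp
    · simp
  refine ⟨fun n => w n • x n, ⟨hfin, fun hp => ?_⟩, hz, ?_⟩
  · have h8 := (hx.2 hp).const_smul (8 : 𝕜)
    rw [smul_zero] at h8
    refine h8.congr' ((eventually_ge_atTop N).mono fun n hn => ?_)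
    simp [w, not_lt.2 hn]
  by_contra hcon
  push Not at hcon
  choose u hu v hv huv hnot using fun k : ℕ => hcon (1 / ((k : ℝ) + 1)) (by positivity)
  choose α hα hαs using hu
  choose α' hα' hαs' using hv
  let β : ℕ → ℕ → 𝕜 := fun k n => α k n + (-1 : 𝕜) • α' k n
  have hβ (k : ℕ) : β k ∈ {β : ℕ → 𝕜 | pnorm p.conjExponent β ≤ (2 : ℝ≥0)} := by
    refine (pnorm_add_le _ _).trans ?_
    rw [pnorm_smul, enorm_neg, enorm_one, one_mul]
    exact (add_le_add (hα k) (hα' k)).trans (by norm_num)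
  have hβs (k : ℕ) : HasSum (fun n => β k n • x n) (u k - v k) := by
    convert (hαs k).sub (hαs' k) using 2 with n
    simp [β, add_smul, sub_eq_add_neg]
  obtain ⟨β₀, hβ₀, σ, hσ, hlim⟩ := (isCompact_pnorm_le (𝕜 := 𝕜) (p := p) 2).tendsto_subseq hβ
  have hx0 : HasSum (fun n => β₀ n • x n) 0 := by
    have h1 := ((continuousOn_tsum_smul (𝕜 := 𝕜) hx 2) β₀ hβ₀).tendsto.comp
      (tendsto_nhdsWithin_iff.2 ⟨hlim, Eventually.of_forall fun k => hβ (σ k)⟩)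
    have h2 : Tendsto (fun k => u k - v k) atTop (𝓝 0) := by
      refine squeeze_zero_norm (fun k => ?_) tendsto_one_div_add_atTop_nhds_zero_nat
      rw [← dist_eq_norm]
      exact (huv k).le
    have h3 : (fun β : ℕ → 𝕜 => ∑' n, β n • x n) ∘ β ∘ σ = fun k => u (σ k) - v (σ k) := by
      funext k
      exact (hβs (σ k)).tsum_eq
    rw [h3] at h1
    have h4 := tendsto_nhds_unique h1 (h2.comp hσ.tendsto_atTop)
    have hs := summable_smul_of_pnorm_lt_top (lt_of_le_of_lt hβ₀ ENNReal.coe_lt_top) hx.1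
    simpa only [h4] using hs.hasSum
  have hhead : Tendsto (fun k => ∑ n ∈ Finset.range N,
      ‖((η : ℝ) : 𝕜)⁻¹ • (β (σ k) n - β₀ n)‖ₑ) atTop (𝓝 0) := by
    rw [← Finset.sum_const_zero (s := Finset.range N)]
    refine tendsto_finsetSum _ fun n _ => ?_
    have h1 : Tendsto (fun k => β (σ k) n) atTop (𝓝 (β₀ n)) := tendsto_pi_nhds.1 hlim n
    have h2 := ((h1.sub_const (β₀ n)).const_smul (((η : ℝ) : 𝕜)⁻¹)).enorm
    simpa only [sub_self, smul_zero, enorm_zero] using h2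
  obtain ⟨k, hk⟩ := (hhead.eventually_lt_const (u := 2⁻¹) (by simp)).exists
  refine hnot (σ k) ⟨fun n => (w n)⁻¹ • (β (σ k) n - β₀ n), ?_, ?_⟩
  · have hγ : pnorm p.conjExponent (fun n => β (σ k) n - β₀ n) ≤ 4 := by
      calc pnorm p.conjExponent (fun n => β (σ k) n - β₀ n)
          = pnorm p.conjExponent (fun n => β (σ k) n + (-1 : 𝕜) • β₀ n) := by
            simp [sub_eq_add_neg]
        _ ≤ _ := pnorm_add_le _ _
        _ ≤ 2 + 2 := by
            rw [pnorm_smul, enorm_neg, enorm_one, one_mul]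
            exact add_le_add (hβ (σ k)) hβ₀
        _ = 4 := by norm_num
    calc pnorm p.conjExponent (fun n => (w n)⁻¹ • (β (σ k) n - β₀ n))
        = pnorm p.conjExponent (fun n => (∑ m ∈ Finset.range N,
            if n = m then ((η : ℝ) : 𝕜)⁻¹ • (β (σ k) m - β₀ m) else 0)
            + (if n < N then 0 else (8 : 𝕜)⁻¹ • (β (σ k) n - β₀ n))) := by
          congr 1
          funext n
          simp only [w, Finset.sum_ite_eq, Finset.mem_range]
          split_ifs <;> simp
      _ ≤ _ := pnorm_add_le _ _
      _ ≤ (∑ m ∈ Finset.range N, ‖((η : ℝ) : 𝕜)⁻¹ • (β (σ k) m - β₀ m)‖ₑ)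
            + pnorm p.conjExponent (fun n => (8 : 𝕜)⁻¹ • (β (σ k) n - β₀ n)) := by
          refine add_le_add ((pnorm_finset_sum_le _ _).trans ?_) (pnorm_mono fun n => ?_)
          · simp only [pnorm_single, le_refl]
          · split_ifs <;> simp
      _ ≤ 2⁻¹ + 8⁻¹ * 4 := by
          rw [pnorm_smul, enorm_inv (by norm_num), h8e]
          gcongr
      _ = 1 := by
          rw [show (8 : ℝ≥0∞) = 2 * 4 by norm_num, ENNReal.mul_inv (by simp) (by simp), mul_assoc,
            ENNReal.inv_mul_cancel (by simp) (by simp), mul_one, ENNReal.inv_two_add_inv_two]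
  · have h := (hβs (σ k)).sub hx0
    rw [sub_zero] at h
    convert h using 2 with n
    dsimp only
    rw [smul_smul, smul_eq_mul, mul_right_comm, inv_mul_cancel₀ (hw0 n), one_mul, sub_smul]

end hullCompact

/-! ### Partitions of unity and the tensor product -/

section partition

variable {𝕜 : Type*} [RCLike 𝕜] {Ω : Type*} [TopologicalSpace Ω]

/-- A finite partition of unity on a compact space, with members indexed by points, which is
subordinate to the cover by the preimages of `δ`-balls under a continuous map `G`. -/
lemma exists_partition_dist_lt [CompactSpace Ω] {M : Type*} [PseudoMetricSpace M] (G : C(Ω, M))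
    {δ : ℝ} (hδ : 0 < δ) :
    ∃ (t : Finset Ω) (w : Ω → C(Ω, ℝ)), (∀ a ω, 0 ≤ w a ω) ∧ (∀ ω, ∑ a ∈ t, w a ω = 1) ∧
      ∀ a ω, w a ω ≠ 0 → dist (G ω) (G a) < δ := by
  obtain ⟨t, -, ht⟩ := isCompact_univ.elim_nhds_subcover (fun a => G ⁻¹' Metric.ball (G a) δ)
    fun a _ => G.continuous.continuousAt.preimage_mem_nhds (Metric.ball_mem_nhds _ hδ)
  let b (a ω : Ω) : ℝ := max 0 (δ - dist (G ω) (G a))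
  have hb (a ω) : 0 ≤ b a ω := le_max_left _ _
  have hpos (ω : Ω) : 0 < ∑ a ∈ t, b a ω := by
    obtain ⟨a, ha, hω⟩ := Set.mem_iUnion₂.1 (ht (Set.mem_univ ω))
    refine Finset.sum_pos' (fun a _ => hb a ω) ⟨a, ha, lt_max_of_lt_right ?_⟩
    exact sub_pos.2 hω
  refine ⟨t, fun a => ⟨fun ω => b a ω / ∑ a ∈ t, b a ω, ?_⟩, fun a ω => ?_, fun ω => ?_,
    fun a ω h => ?_⟩
  · refine Continuous.div ?_ ?_ fun ω => (hpos ω).ne' <;> simp only [b] <;> fun_prop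
  · exact div_nonneg (hb a ω) (hpos ω).le
  · simp only [ContinuousMap.coe_mk]
    rw [← Finset.sum_div, div_self (hpos ω).ne']
  · by_contra hlt
    refine h ?_
    simp only [ContinuousMap.coe_mk, b]
    rw [max_eq_left (by linarith), zero_div]

/-- A real continuous function, regarded as a `𝕜`-valued one. -/
def toScalar (𝕜 : Type*) [RCLike 𝕜] (w : C(Ω, ℝ)) : C(Ω, 𝕜) :=
  ⟨fun ω => ((w ω : ℝ) : 𝕜), by fun_prop⟩

@[simp] lemma toScalar_apply (w : C(Ω, ℝ)) (ω : Ω) : toScalar 𝕜 w ω = ((w ω : ℝ) : 𝕜) := rfl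

lemma sub_sum_partition {E : Type*} [NormedAddCommGroup E] [NormedSpace 𝕜 E] {t : Finset Ω}
    {w : Ω → C(Ω, ℝ)} (h1 : ∀ ω, ∑ a ∈ t, w a ω = 1) (f : Ω → E) (ω : Ω) :
    f ω - ∑ a ∈ t, toScalar 𝕜 (w a) ω • f a
      = ∑ a ∈ t, ((w a ω : ℝ) : 𝕜) • (f ω - f a) := by
  simp only [smul_sub, Finset.sum_sub_distrib, toScalar_apply]
  rw [← Finset.sum_smul, ← RCLike.ofReal_sum, h1, RCLike.ofReal_one, one_smul]

end partition

section tensor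

variable {𝕜 : Type*} [RCLike 𝕜] {Ω X Y : Type*} [TopologicalSpace Ω]
    [NormedAddCommGroup X] [NormedSpace 𝕜 X] [NormedAddCommGroup Y] [NormedSpace 𝕜 Y]
    {S : C(Ω, 𝕜) →L[𝕜] X →L[𝕜] Y}

/-- The bilinear map `(φ, x) ↦ (S φ) x`, extended to the algebraic tensor product. -/
def tensorLift (S : C(Ω, 𝕜) →L[𝕜] X →L[𝕜] Y) : C(Ω, 𝕜) ⊗[𝕜] X →ₗ[𝕜] Y :=
  TensorProduct.lift (LinearMap.mk₂ 𝕜 (fun φ x => S φ x) (by simp) (by simp) (by simp) (by simp))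

@[simp] lemma tensorLift_tmul (φ : C(Ω, 𝕜)) (x : X) : tensorLift S (φ ⊗ₜ x) = S φ x := rfl

/-- The canonical map from `C(Ω) ⊗ X` to `C(Ω, X)`. -/
def tensorToC (𝕜 Ω X : Type*) [RCLike 𝕜] [TopologicalSpace Ω] [NormedAddCommGroup X]
    [NormedSpace 𝕜 X] : C(Ω, 𝕜) ⊗[𝕜] X →ₗ[𝕜] C(Ω, X) :=
  TensorProduct.lift (LinearMap.mk₂ 𝕜 elem
    (fun φ ψ x => ContinuousMap.ext fun ω => add_smul (φ ω) (ψ ω) x)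
    (fun c φ x => ContinuousMap.ext fun ω => mul_smul c (φ ω) x)
    (fun φ x y => ContinuousMap.ext fun ω => smul_add (φ ω) x y)
    (fun c φ x => ContinuousMap.ext fun ω => smul_comm (φ ω) c x))

lemma tensorToC_sum_apply {ι : Type*} (t : Finset ι) (φ : ι → C(Ω, 𝕜)) (x : ι → X) (ω : Ω) :
    tensorToC 𝕜 Ω X (∑ i ∈ t, φ i ⊗ₜ x i) ω = ∑ i ∈ t, φ i ω • x i := by
  rw [map_sum, ContinuousMap.sum_apply]
  rfl

end tensor

section operators

variable {𝕜 : Type*} [RCLike 𝕜] {Ω X Y : Type*} [TopologicalSpace Ω] [CompactSpace Ω]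
    [NormedAddCommGroup X] [NormedSpace 𝕜 X] [NormedAddCommGroup Y] [NormedSpace 𝕜 Y]
    {p : ℝ≥0∞} [Fact (1 ≤ p)] {S : C(Ω, 𝕜) →L[𝕜] X →L[𝕜] Y}

lemma enorm_continuousMap_le {φ : C(Ω, X)} {C : ℝ≥0∞} (h : ∀ ω, ‖φ ω‖ₑ ≤ C) : ‖φ‖ₑ ≤ C := by
  by_cases hC : C = ∞
  · simp [hC]
  · rw [← ENNReal.ofReal_toReal hC, ← ofReal_norm]
    refine ENNReal.ofReal_le_ofReal ((ContinuousMap.norm_le _ ENNReal.toReal_nonneg).2 fun ω => ?_)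
    simpa using ENNReal.toReal_mono hC (h ω)

/-- In `C(Ω)` weak norms are bounded by pointwise norms. -/
lemma wnorm_le_of_pointwise {ι : Type*} {φ : ι → C(Ω, 𝕜)} {C : ℝ≥0∞}
    (h : ∀ ω, pnorm p.conjExponent (fun i => φ i ω) ≤ C) : wnorm 𝕜 p.conjExponent φ ≤ C := by
  refine wnorm_le_of_dual fun s a ha => enorm_continuousMap_le fun ω => ?_
  rw [ContinuousMap.sum_apply]
  refine (enorm_sum_le _ _).trans ?_
  simp only [ContinuousMap.smul_apply, enorm_smul]
  exact (sum_enorm_mul_le s a _).trans ((mul_le_of_le_one_left' ha).trans (h ω))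

lemma pnorm_eval_le_wnorm {ι : Type*} (q : ℝ≥0∞) (φ : ι → C(Ω, 𝕜)) (ω : Ω) :
    pnorm q (fun i => φ i ω) ≤ wnorm 𝕜 q φ := by
  refine wnorm_le_iff.1 le_rfl (ContinuousMap.evalCLM 𝕜 ω) ?_
  refine ContinuousLinearMap.opNorm_le_bound _ zero_le_one fun φ => ?_
  rw [one_mul]
  exact φ.norm_coe_le_norm ω

/-- The inequality for finite systems, combined with Hölder's inequality. -/
lemma enorm_sum_apply_le {c : ℝ≥0}
    (h : ∀ (n : ℕ) (x : Fin n → X) (φ : Fin n → C(Ω, 𝕜)),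
      wnorm 𝕜 p.conjExponent (fun i => S (φ i) (x i))
        ≤ c * pnorm ∞ x * wnorm 𝕜 p.conjExponent φ)
    {ι : Type*} (s : Finset ι) (x : ι → X) (φ : ι → C(Ω, 𝕜)) :
    ‖∑ i ∈ s, S (φ i) (x i)‖ₑ ≤ c * pnorm p x * wnorm 𝕜 p.conjExponent φ := by
  let a (i : ι) : 𝕜 := ((‖x i‖ : ℝ) : 𝕜)
  have ha (i : ι) : ‖a i‖ₑ = ‖x i‖ₑ := by
    rw [← ofReal_norm, ← ofReal_norm, RCLike.norm_ofReal, abs_norm]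
  have hx (i : ι) : a i • ((a i)⁻¹ • x i) = x i := by
    by_cases h0 : x i = 0
    · simp [h0]
    · exact smul_inv_smul₀ (by simpa [a] using h0) _
  have h1 : pnorm ∞ (fun i => (a i)⁻¹ • x i) ≤ 1 := by
    refine pnorm_top_le_iff.2 fun i => ?_
    rw [← ofReal_norm]
    refine ENNReal.ofReal_le_one.2 ?_
    rw [norm_smul, norm_inv, RCLike.norm_ofReal, abs_norm]
    exact inv_mul_le_one
  calc ‖∑ i ∈ s, S (φ i) (x i)‖ₑ = ‖∑ i ∈ s, a i • S (φ i) ((a i)⁻¹ • x i)‖ₑ := by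
        congr 1
        refine Finset.sum_congr rfl fun i _ => ?_
        rw [← map_smul, hx]
    _ ≤ pnorm p a * wnorm 𝕜 p.conjExponent (fun i => S (φ i) ((a i)⁻¹ • x i)) :=
        enorm_sum_smul_le _ _ _
    _ ≤ pnorm p x * (c * 1 * wnorm 𝕜 p.conjExponent φ) := by
        gcongr
        · exact pnorm_mono fun i => (ha i).le
        · exact (wnorm_apply_le_of_finite h _ _).trans (by gcongr)
    _ = _ := by ring

/-- The canonical map from `C(Ω) ⊗ X` to `C_p(Ω, X)`. -/
def tensorToCp (𝕜 : Type*) [RCLike 𝕜] (p : ℝ≥0∞) [Fact (1 ≤ p)] (Ω X : Type*)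
    [TopologicalSpace Ω] [CompactSpace Ω] [NormedAddCommGroup X] [NormedSpace 𝕜 X] :
    C(Ω, 𝕜) ⊗[𝕜] X →ₗ[𝕜] Cp 𝕜 p Ω X :=
  TensorProduct.lift (LinearMap.mk₂ 𝕜 (Cp.elem p)
    (fun φ ψ x => Subtype.ext <| ContinuousMap.ext fun ω => add_smul (φ ω) (ψ ω) x)
    (fun c φ x => Subtype.ext <| ContinuousMap.ext fun ω => mul_smul c (φ ω) x)
    (fun φ x y => Subtype.ext <| ContinuousMap.ext fun ω => smul_add (φ ω) x y)
    (fun c φ x => Subtype.ext <| ContinuousMap.ext fun ω => smul_comm (φ ω) c x))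

/-- The inclusion of `C_p(Ω, X)` into `C(Ω, X)`. -/
def Cp.toCₗ (𝕜 : Type*) [RCLike 𝕜] (p : ℝ≥0∞) [Fact (1 ≤ p)] (Ω X : Type*)
    [TopologicalSpace Ω] [NormedAddCommGroup X] [NormedSpace 𝕜 X] :
    Cp 𝕜 p Ω X →ₗ[𝕜] C(Ω, X) where
  toFun := Cp.toC
  map_add' _ _ := rfl
  map_smul' _ _ := rfl

lemma toC_tensorToCp (u : C(Ω, 𝕜) ⊗[𝕜] X) :
    Cp.toCₗ 𝕜 p Ω X (tensorToCp 𝕜 p Ω X u) = tensorToC 𝕜 Ω X u := by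
  induction u using TensorProduct.induction_on with
  | zero => simp
  | tmul φ x => rfl
  | add u v hu hv => rw [map_add, map_add, map_add, hu, hv]

/-- The value of the lift of `S` at a tensor `u` with associated function `f` is approximated by
the values `∑ (S ψ_a) (f a)` along partitions of unity `(ψ_a)`. -/
lemma norm_tensorLift_le (u : C(Ω, 𝕜) ⊗[𝕜] X) {K : ℝ}
    (h : ∀ (t : Finset Ω) (w : Ω → C(Ω, ℝ)), (∀ a ω, 0 ≤ w a ω) →
      (∀ ω, ∑ a ∈ t, w a ω = 1) →
      ‖∑ a ∈ t, S (toScalar 𝕜 (w a)) (tensorToC 𝕜 Ω X u a)‖ ≤ K) :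
    ‖tensorLift S u‖ ≤ K := by
  refine le_of_forall_pos_le_add fun ε hε => ?_
  obtain ⟨J, rfl⟩ := TensorProduct.exists_finset u
  set B : ℝ := ∑ j ∈ J, ‖S‖ * ‖j.2‖ with hB
  have hB0 : 0 ≤ B := Finset.sum_nonneg fun j _ => by positivity
  -- The partition is chosen fine enough for all the scalar functions that occur in `u`.
  let G : C(Ω, J → 𝕜) := ⟨fun ω j => j.1.1 ω, by fun_prop⟩
  obtain ⟨t, w, hw0, hw1, hw⟩ := exists_partition_dist_lt G (δ := ε / (B + 1)) (by positivity)
  have hφ (j) (hj : j ∈ J) :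
      ‖j.1 - ∑ a ∈ t, (j.1 a) • toScalar 𝕜 (w a)‖ ≤ ε / (B + 1) := by
    refine (ContinuousMap.norm_le _ (by positivity)).2 fun ω => ?_
    have h1 := sub_sum_partition (𝕜 := 𝕜) hw1 j.1 ω
    simp only [smul_eq_mul] at h1
    rw [ContinuousMap.sub_apply, ContinuousMap.sum_apply]
    simp only [ContinuousMap.smul_apply, smul_eq_mul]
    simp only [mul_comm (j.1 _)]
    rw [h1]
    refine norm_convex_combination_le (𝕜 := 𝕜) (fun a => hw0 a ω) (hw1 ω)
      (v := fun a => j.1 ω - j.1 a) fun a ha => ?_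
    rw [← dist_eq_norm]
    exact (dist_le_pi_dist (G ω) (G a) ⟨j, hj⟩).trans (hw a ω ha).le
  have hsum : ∑ a ∈ t, S (toScalar 𝕜 (w a)) (tensorToC 𝕜 Ω X (∑ j ∈ J, j.1 ⊗ₜ j.2) a)
      = ∑ j ∈ J, S (∑ a ∈ t, (j.1 a) • toScalar 𝕜 (w a)) j.2 := by
    simp only [tensorToC_sum_apply]
    simp only [map_sum, map_smul, sum_apply, smul_apply]
    rw [Finset.sum_comm]
  have hdiff : ‖tensorLift S (∑ j ∈ J, j.1 ⊗ₜ j.2)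
      - ∑ a ∈ t, S (toScalar 𝕜 (w a)) (tensorToC 𝕜 Ω X (∑ j ∈ J, j.1 ⊗ₜ j.2) a)‖ ≤ ε := by
    rw [hsum, map_sum, ← Finset.sum_sub_distrib]
    calc _ ≤ ∑ j ∈ J, ‖S‖ * ‖j.2‖ * (ε / (B + 1)) := by
          refine norm_sum_le_of_le _ fun j hj => ?_
          rw [tensorLift_tmul, ← sub_apply, ← map_sub]
          refine (S.le_opNorm₂ _ _).trans ?_
          rw [mul_right_comm]
          gcongr
          exact hφ j hj
      _ = B * (ε / (B + 1)) := by rw [← Finset.sum_mul]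
      _ ≤ ε := by
          rw [mul_div_assoc', div_le_iff₀ (by positivity)]
          nlinarith
  have h2 := norm_sub_norm_le (tensorLift S (∑ j ∈ J, j.1 ⊗ₜ j.2))
    (∑ a ∈ t, S (toScalar 𝕜 (w a)) (tensorToC 𝕜 Ω X (∑ j ∈ J, j.1 ⊗ₜ j.2) a))
  linarith [h t w hw0 hw1]

/-! ### Operators on `C(Ω, X)` -/

lemma denseRange_tensorToC : DenseRange (tensorToC 𝕜 Ω X) := by
  refine Metric.denseRange_iff.2 fun f ε hε => ?_
  obtain ⟨t, w, hw0, hw1, hw⟩ := exists_partition_dist_lt f (half_pos hε)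
  refine ⟨∑ a ∈ t, toScalar 𝕜 (w a) ⊗ₜ f a, ?_⟩
  rw [dist_eq_norm]
  refine lt_of_le_of_lt ((ContinuousMap.norm_le _ (half_pos hε).le).2 fun ω => ?_) (half_lt_self hε)
  rw [ContinuousMap.sub_apply, tensorToC_sum_apply, sub_sum_partition hw1]
  refine norm_convex_combination_le (fun a => hw0 a ω) (hw1 ω) fun a ha => ?_
  rw [← dist_eq_norm]
  exact (hw a ω ha).le

lemma FiniteIneq.isAssocC [CompleteSpace Y] (h : FiniteIneq 1 S) : IsAssocC S := by
  rw [← conjExponent_top] at h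
  obtain ⟨c, -, h⟩ := h
  have : Fact (1 ≤ ∞) := ⟨le_top⟩
  have hbound : ∃ C : ℝ, ∀ u, ‖tensorLift S u‖ ≤ C * ‖tensorToC 𝕜 Ω X u‖ := by
    refine ⟨c, fun u => norm_tensorLift_le u fun t w hw0 hw1 => ?_⟩
    set f := tensorToC 𝕜 Ω X u
    have h1 := enorm_sum_apply_le (p := ∞) h Finset.univ (fun a : t => f a)
      (fun a : t => toScalar 𝕜 (w a))
    rw [Finset.sum_coe_sort t fun a => S (toScalar 𝕜 (w a)) (f a)] at h1
    have h2 : pnorm ∞ (fun a : t => f a) ≤ ‖f‖ₑ := pnorm_top_le_iff.2 fun a => by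
      rw [← ofReal_norm, ← ofReal_norm]
      exact ENNReal.ofReal_le_ofReal (f.norm_coe_le_norm a)
    have h3 : wnorm 𝕜 (ENNReal.conjExponent ∞) (fun a : t => toScalar 𝕜 (w a)) ≤ 1 := by
      refine wnorm_le_of_pointwise fun ω => le_of_eq ?_
      rw [conjExponent_top, pnorm_of_ne_top ENNReal.one_ne_top]
      simp only [ENNReal.toReal_one, ENNReal.rpow_one, div_one, tsum_fintype, toScalar_apply]
      rw [Finset.sum_coe_sort t fun a => ‖((w a ω : ℝ) : 𝕜)‖ₑ]
      exact sum_enorm_ofReal (fun a => hw0 a ω) (hw1 ω)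
    have h4 := h1.trans (mul_le_mul' (mul_le_mul' le_rfl h2) h3)
    rw [mul_one, enorm_eq_nnnorm, enorm_eq_nnnorm, ← ENNReal.coe_mul, ENNReal.coe_le_coe] at h4
    exact_mod_cast h4
  exact ⟨(tensorLift S).extendOfNorm (tensorToC 𝕜 Ω X), fun φ x =>
    (LinearMap.extendOfNorm_eq denseRange_tensorToC hbound (φ ⊗ₜ x)).symm⟩

/-! ### Operators on `C_p(Ω, X)` -/

lemma IsAssocC.isAssocCp (h : IsAssocC S) : IsAssocCp p S := by
  obtain ⟨U, hU⟩ := h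
  refine ⟨U.comp ((Cp.toCₗ 𝕜 p Ω X).mkContinuous 1 fun f => ?_), hU⟩
  rw [one_mul]
  refine le_of_forall_pos_le_add fun ε hε => ?_
  obtain ⟨x, -, hfx, hlt⟩ := f.exists_lt (r := ‖f‖ + ε) (by linarith)
  refine (ContinuousMap.norm_le _ (by positivity)).2 fun ω => ?_
  have := (enorm_le_of_mem_hull (hfx ⟨ω, rfl⟩)).trans hlt
  rwa [← ofReal_norm, ENNReal.ofReal_le_ofReal_iff (by positivity)] at this

/-- Finite-rank functions are dense in `C_p(Ω, X)`. -/
lemma denseRange_tensorToCp [CompleteSpace X] : DenseRange (tensorToCp 𝕜 p Ω X) := by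
  refine Metric.denseRange_iff.2 fun f ε hε => ?_
  obtain ⟨x, hx, hfx⟩ := f.2
  obtain ⟨z, hz, hzε, δ, hδ, hsub⟩ :=
    exists_sub_mem_hull_of_dist_lt (𝕜 := 𝕜) hx (ENNReal.ofReal_pos.2 (half_pos hε))
  obtain ⟨t, w, hw0, hw1, hw⟩ := exists_partition_dist_lt f.toC hδ
  refine ⟨∑ a ∈ t, toScalar 𝕜 (w a) ⊗ₜ f.toC a, ?_⟩
  rw [dist_eq_norm]
  refine lt_of_le_of_lt (Cp.norm_le _ hz ?_) (lt_of_le_of_lt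
    (ENNReal.toReal_le_of_le_ofReal (half_pos hε).le hzε) (half_lt_self hε))
  rintro _ ⟨ω, rfl⟩
  have h1 : (f - tensorToCp 𝕜 p Ω X (∑ a ∈ t, toScalar 𝕜 (w a) ⊗ₜ f.toC a)).toC ω
      = f.toC ω - tensorToC 𝕜 Ω X (∑ a ∈ t, toScalar 𝕜 (w a) ⊗ₜ f.toC a) ω := by
    rw [← toC_tensorToCp (p := p)]
    rfl
  rw [h1, tensorToC_sum_apply, sub_sum_partition hw1]
  exact convex_combination_mem_hull (fun a => hw0 a ω) (hw1 ω) fun a ha =>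
    hsub _ (hfx ⟨ω, rfl⟩) _ (hfx ⟨a, rfl⟩) (hw a ω ha)

lemma norm_tensorLift_le_norm_tensorToCp {c : ℝ≥0}
    (h : ∀ (n : ℕ) (x : Fin n → X) (φ : Fin n → C(Ω, 𝕜)),
      wnorm 𝕜 p.conjExponent (fun i => S (φ i) (x i))
        ≤ c * pnorm ∞ x * wnorm 𝕜 p.conjExponent φ) (u : C(Ω, 𝕜) ⊗[𝕜] X) :
    ‖tensorLift S u‖ ≤ c * ‖tensorToCp 𝕜 p Ω X u‖ := by
  have key (r : ℝ) (hr : ‖tensorToCp 𝕜 p Ω X u‖ < r) : ‖tensorLift S u‖ ≤ c * r := by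
    have hr0 : 0 ≤ r := (norm_nonneg _).trans hr.le
    obtain ⟨x, hx, hfx, hlt⟩ := (tensorToCp 𝕜 p Ω X u).exists_lt hr
    have hfx' (a : Ω) : tensorToC 𝕜 Ω X u a ∈ hull 𝕜 p x := by
      rw [← toC_tensorToCp (p := p)]
      exact hfx ⟨a, rfl⟩
    choose α hα hs using hfx'
    refine norm_tensorLift_le u fun t w hw0 hw1 => ?_
    -- Averaging the coefficients yields continuous coefficient functions.
    let φ (n : ℕ) : C(Ω, 𝕜) := ∑ a ∈ t, α a n • toScalar 𝕜 (w a)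
    have hφ : wnorm 𝕜 p.conjExponent φ ≤ 1 := by
      refine wnorm_le_of_pointwise fun ω => ?_
      have := pnorm_convex_combination_le (𝕜 := 𝕜) (p := p.conjExponent) (fun a => hw0 a ω)
        (hw1 ω) (α := α) (C := 1) fun a _ => hα a
      simpa [φ, ContinuousMap.sum_apply, mul_comm] using this
    have hsum : HasSum (fun n => S (φ n) (x n))
        (∑ a ∈ t, S (toScalar 𝕜 (w a)) (tensorToC 𝕜 Ω X u a)) := by
      convert hasSum_sum (s := t) fun a _ => (hs a).mapL (S (toScalar 𝕜 (w a))) using 2 with n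
      simp only [φ, map_sum, map_smul, sum_apply, smul_apply]
    have hen : ‖∑ a ∈ t, S (toScalar 𝕜 (w a)) (tensorToC 𝕜 Ω X u a)‖ₑ
        ≤ ENNReal.ofReal (c * r) := by
      refine le_of_tendsto hsum.enorm (Eventually.of_forall fun s => ?_)
      refine (enorm_sum_apply_le h s x φ).trans ?_
      rw [ENNReal.ofReal_mul c.coe_nonneg, ENNReal.ofReal_coe_nnreal]
      exact (mul_le_of_le_one_right' hφ).trans (mul_le_mul' le_rfl hlt)
    rwa [← ofReal_norm, ENNReal.ofReal_le_ofReal_iff (by positivity)] at hen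
  have hlim : Tendsto (fun r : ℝ => (c : ℝ) * r) (𝓝[>] ‖tensorToCp 𝕜 p Ω X u‖)
      (𝓝 (c * ‖tensorToCp 𝕜 p Ω X u‖)) :=
    ((continuous_const_mul (c : ℝ)).tendsto _).mono_left nhdsWithin_le_nhds
  exact ge_of_tendsto hlim (eventually_mem_nhdsWithin.mono key)

lemma FiniteIneq.isAssocCp [CompleteSpace X] [CompleteSpace Y]
    (h : FiniteIneq p.conjExponent S) : IsAssocCp p S := by
  obtain ⟨c, -, h⟩ := h
  have hbound : ∃ C : ℝ, ∀ u, ‖tensorLift S u‖ ≤ C * ‖tensorToCp 𝕜 p Ω X u‖ :=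
    ⟨c, norm_tensorLift_le_norm_tensorToCp h⟩
  exact ⟨(tensorLift S).extendOfNorm (tensorToCp 𝕜 p Ω X), fun φ x =>
    (LinearMap.extendOfNorm_eq (f := tensorLift S) (e := tensorToCp 𝕜 p Ω X)
      denseRange_tensorToCp hbound (φ ⊗ₜ x)).symm⟩

/-- If the weak norm of `(φᵢ)` is at most one, then the values of `∑ φᵢ xᵢ` lie in the hull of
`(xᵢ)`. -/
lemma enorm_sum_elem_le {n : ℕ} (x : Fin n → X) {φ : Fin n → C(Ω, 𝕜)}
    (hφ : wnorm 𝕜 p.conjExponent φ ≤ 1) : ‖∑ i, Cp.elem p (φ i) (x i)‖ₑ ≤ pnorm p x := by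
  have hinj : Function.Injective (Fin.val : Fin n → ℕ) := Fin.val_injective
  let z : ℕ → X := Function.extend Fin.val x 0
  have hz0 (m : ℕ) (hm : m ∉ Set.range (Fin.val : Fin n → ℕ)) : z m = 0 :=
    Function.extend_apply' _ _ _ hm
  have hzx (i : Fin n) : z i = x i := hinj.extend_apply _ _ _
  have hzn : pnorm p z ≤ pnorm p x :=
    (pnorm_le_pnorm_comp hinj hz0).trans (by simp only [hzx, le_refl])
  have hxfin : pnorm p x < ∞ := (pnorm_lt_top_iff x).2 (Memℓp.all x)
  have hz : MemLpC0 p z := ⟨hzn.trans_lt hxfin, fun _ => tendsto_const_nhds.congr'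
    ((eventually_ge_atTop n).mono fun m hm => (hz0 m (by rintro ⟨i, rfl⟩; omega)).symm)⟩
  have hnorm : ‖∑ i, Cp.elem p (φ i) (x i)‖ ≤ (pnorm p z).toReal := by
    refine Cp.norm_le _ hz ?_
    rintro _ ⟨ω, rfl⟩
    have hval : (∑ i, Cp.elem p (φ i) (x i)).toC ω = ∑ i, φ i ω • x i := by
      have := toC_tensorToCp (p := p) (∑ i, φ i ⊗ₜ[𝕜] x i)
      rw [map_sum] at this
      rw [← tensorToC_sum_apply, ← this]
      rfl
    let α : ℕ → 𝕜 := Function.extend Fin.val (fun i => φ i ω) 0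
    have hαφ (i : Fin n) : α i = φ i ω := hinj.extend_apply _ _ _
    refine ⟨α, ?_, ?_⟩
    · refine (pnorm_le_pnorm_comp hinj fun m hm =>
        Function.extend_apply' (fun i => φ i ω) (0 : ℕ → 𝕜) m hm).trans ?_
      refine le_trans (le_of_eq ?_) ((pnorm_eval_le_wnorm _ φ ω).trans hφ)
      exact congrArg _ (funext hαφ)
    · rw [hval, ← hinj.hasSum_iff fun m hm => by simp [hz0 m hm]]
      convert hasSum_fintype (fun i => φ i ω • x i) using 2 with i
      simp [hzx, hαφ]
  rw [← ofReal_norm]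
  exact (ENNReal.ofReal_le_of_le_toReal hnorm).trans hzn

lemma IsAssocCp.finiteIneq (h : IsAssocCp p S) : FiniteIneq p.conjExponent S := by
  obtain ⟨U, hU⟩ := h
  refine finiteIneq_of_normalized ‖U‖₊ fun n x φ hx hφ => wnorm_le_of_dual fun s a ha => ?_
  let y (i : Fin n) : X := if i ∈ s then a i • x i else 0
  have hsum : ∑ i ∈ s, a i • S (φ i) (x i) = U (∑ i, Cp.elem p (φ i) (y i)) := by
    rw [map_sum]
    simp only [← hU, y]
    rw [← Finset.sum_subset s.subset_univ fun i _ hi => by rw [if_neg hi, map_zero]]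
    exact Finset.sum_congr rfl fun i hi => by rw [if_pos hi, map_smul]
  have hy : pnorm p y ≤ 1 := by
    refine (pnorm_mono fun i => ?_).trans ha
    simp only [y]
    split_ifs
    · rw [enorm_smul]
      exact mul_le_of_le_one_right' (hx i)
    · simp
  rw [hsum]
  calc ‖U (∑ i, Cp.elem p (φ i) (y i))‖ₑ ≤ ‖U‖ₑ * ‖∑ i, Cp.elem p (φ i) (y i)‖ₑ :=
        U.le_opENorm _
    _ ≤ ‖U‖ₑ * 1 := by gcongr; exact (enorm_sum_elem_le y hφ).trans hy
    _ = _ := by rw [mul_one]; rfl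

end operators

end PCont

open PCont
theorem corollary3p4 {𝕜 : Type*} [RCLike 𝕜] {Ω : Type*} [TopologicalSpace Ω] [CompactSpace Ω]
    [T2Space Ω] {X Y : Type*} [NormedAddCommGroup X] [NormedSpace 𝕜 X] [CompleteSpace X]
    [NormedAddCommGroup Y] [NormedSpace 𝕜 Y] [CompleteSpace Y]
    (S : C(Ω, 𝕜) →L[𝕜] X →L[𝕜] Y) :
    (∀ (p : ℝ≥0∞) [Fact (1 ≤ p)],
      List.TFAE [
        IsAssocCp p S,
        FiniteIneq p.conjExponent S,
        TailIneq p.conjExponent S,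
        MapsBddWeak p.conjExponent S,
        MapsC0Weak p.conjExponent S,
        MapsBddUncond p.conjExponent S]) ∧
    List.TFAE [
      IsAssocC S,
      FiniteIneq 1 S,
      TailIneq 1 S,
      MapsBddWeak 1 S,
      MapsC0Weak 1 S,
      MapsBddUncond 1 S] := by
  refine ⟨fun p _ => ?_, ?_⟩
  · exact (List.tfae_cons_of_mem (b := FiniteIneq p.conjExponent S) List.mem_cons_self).2
      ⟨⟨IsAssocCp.finiteIneq, FiniteIneq.isAssocCp⟩, tfae_sequence_conditions p S⟩
  · have : Fact ((1 : ℝ≥0∞) ≤ ∞) := ⟨le_top⟩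
    have h := tfae_sequence_conditions ∞ S
    rw [conjExponent_top] at h
    refine (List.tfae_cons_of_mem (b := FiniteIneq 1 S) List.mem_cons_self).2
      ⟨⟨fun hU => ?_, FiniteIneq.isAssocC⟩, h⟩
    have := (hU.isAssocCp (p := ∞)).finiteIneq
    rwa [conjExponent_top] at this
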